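/- Let $X_1,X_2,\dots$ be observations that are i.i.d. under each law $P_i$ of a statistical model $(P_i)_{i\in I}$, and let $\vartheta_i\in\mathbb R^p$ be the parameter value under $P_i$. Let $\hat\vartheta_m=\hat\vartheta_m(X_1,\dots,X_m)$ be generalized method of moments estimators: for a moment function $\gamma$ with values in $\mathbb R^q$ and $E_{P_i}\gamma(X_1,\vartheta_i)=0$ for every $i$, a parameter set $T\ni\vartheta_i$, and data-dependent positive semidefinite weight matrices $W_m$ that converge in probability under each $P_i$ to a positive definite matrix, $\hat\vartheta_m$ minimizes $\bar\gamma_m(t)^{T}W_m\bar\gamma_m(t)$ over $t\in T$, where $\bar\gamma_m(t)=\frac1m\sum_{j\le m}\gamma(X_j,t)$, with $P_i$-probability tending to one as $m\to\infty$. Let $\hat\theta_m$ and $\theta_i$ (in $\mathbb R^d$) be the subvectors of $\hat\vartheta_m$ and $\vartheta_i$ formed by a fixed selection of coordinates (possibly all). Let $\hat\Sigma_m=\hat\Sigma_m(X_1,\dots,X_m)$ be positive semidefinite matrices that are consistent, under each $P_i$, for a positive definite matrix $\Sigma_i$, and suppose that under each $P_i$ $$\sqrt m\,\hat\Sigma_m^{-1/2}(\hat\theta_m-\theta_i)\Rightarrow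 N(0,I_d)\qquad(m\to\infty).$$ Let $\theta_0\in\mathbb R^d$ be the null value ($H_0:\theta=\theta_0$), and let $g$ be a probability density on $\mathbb R^d$ whose support contains every $\theta_i\neq\theta_0$. Write $\phi(\cdot\mid\mu,S)$ for the density of $N(\mu,S)$. After $n$ batches of $k$ observations let $$\Lambda'_{n,k}=\frac{\int\phi(\hat\theta_{nk}\mid\theta,(nk)^{-1}\hat\Sigma_{nk})\,g(\theta)\,d\theta}{\phi(\hat\theta_{nk}\mid\theta_0,(nk)^{-1}\hat\Sigma_{nk})},$$ and for each $i$ let $$\Lambda^{g,i}_{n,k}=\frac{\int\prod_{j=1}^n\phi(S_j\mid k\theta,k\Sigma_i)\,g(\theta)\,d\theta}{\prod_{j=1}^n\phi(S_j\mid k\theta_0,k\Sigma_i)}$$ be the mixture sequential probability ratio test (mSPRT) statistic for $H_0$ computed from independent normal batch totals $S_1,\dots,S_n\sim N(k\theta_i,k\Sigma_i)$. Then $\Lambda'$ is asymptotically equivalent to this mSPRT: under every law of the model, that is, for every $i\in I$, and for every threshold $x\in\mathbb R$, $$P_i(\Lambda'_{n,k}\le x)-P(\Lambda^{g,i}_{n,k}\le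 x)\to0\qquad\text{as } nk\to\infty,$$ in particular as $n$ and $k$ both become large. If moreover $g$ is continuous and positive at $\theta_0$, then under $H_0$ (for every $i$ with $\theta_i=\theta_0$) this convergence is uniform in $x\in\mathbb R$. -/

import Mathlib

open MeasureTheory ProbabilityTheory Filter Matrix
open scoped Topology MatrixOrder

noncomputable section

/-- The density at `x` of the `d`-dimensional normal law with mean `m` and (positive definite)
covariance matrix `S`. -/
def gaussianDensity {d : ℕ} (x m : EuclideanSpace ℝ (Fin d)) (S : Matrix (Fin d) (Fin d) ℝ) : ℝ :=
  (√((2 * Real.pi) ^ d * S.det))⁻¹ *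
    Real.exp (-((x - m).ofLp ⬝ᵥ (S⁻¹ *ᵥ (x - m).ofLp)) / 2)

/-- The mixture sequential likelihood ratio of the observations `y 0, …, y (n-1)`, for the
likelihood `f t y` of one observation `y` under the parameter `t`, the mixing density `g` and the
null value `t₀`. -/
def mixtureLR {𝒴 : Type*} {d : ℕ} (f : EuclideanSpace ℝ (Fin d) → 𝒴 → ℝ)
    (g : EuclideanSpace ℝ (Fin d) → ℝ) (t₀ : EuclideanSpace ℝ (Fin d)) {n : ℕ} (y : Fin n → 𝒴) :
    ℝ :=
  (∫ t, (∏ j, f t (y j)) * g t) / ∏ j, f t₀ (y j)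

/-- The Gaussian-approximation mixture ratio: the ratio of `∫ φ(x | t, S) g(t) dt` and
`φ(x | t₀, S)`. -/
def gaussianMixtureRatio {d : ℕ} (g : EuclideanSpace ℝ (Fin d) → ℝ)
    (t₀ x : EuclideanSpace ℝ (Fin d)) (S : Matrix (Fin d) (Fin d) ℝ) : ℝ :=
  (∫ t, gaussianDensity x t S * g t) / gaussianDensity x t₀ S

/-- The first `m` observations. -/
def sample {Ω 𝒳 : Type*} (X : ℕ → Ω → 𝒳) (m : ℕ) (ω : Ω) : Fin m → 𝒳 := fun j => X j ω

/-- The sample moment `(1/m) ∑ γ(x_j, t)`. -/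
def sampleMoment {𝒳 : Type*} {p q : ℕ}
    (γ : 𝒳 → EuclideanSpace ℝ (Fin p) → EuclideanSpace ℝ (Fin q)) {m : ℕ} (x : Fin m → 𝒳)
    (t : EuclideanSpace ℝ (Fin p)) : EuclideanSpace ℝ (Fin q) :=
  (m : ℝ)⁻¹ • ∑ j, γ (x j) t

/-- The GMM criterion: the quadratic form of the weight matrix `W` at the sample moment. -/
def gmmObjective {𝒳 : Type*} {p q : ℕ}
    (γ : 𝒳 → EuclideanSpace ℝ (Fin p) → EuclideanSpace ℝ (Fin q))
    (W : Matrix (Fin q) (Fin q) ℝ) {m : ℕ} (x : Fin m → 𝒳) (t : EuclideanSpace ℝ (Fin p)) : ℝ :=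
  (sampleMoment γ x t).ofLp ⬝ᵥ (W *ᵥ (sampleMoment γ x t).ofLp)

/-- A sequence of matrix-valued statistics is a consistent estimate of the matrix `A`: every entry
converges in probability. -/
def IsConsistentFor {Ω : Type*} [MeasurableSpace Ω] (P : Measure Ω) {r : ℕ}
    (M : ℕ → Ω → Matrix (Fin r) (Fin r) ℝ) (A : Matrix (Fin r) (Fin r) ℝ) : Prop :=
  ∀ a b, TendstoInMeasure P (fun m ω => M m ω a b) atTop (fun _ => A a b)

/-- `est` is a sequence of generalized method of moments estimators under the law `P` with true
parameter `t`: the moment function has mean zero at the true parameter, the weight matrices are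
positive semidefinite with a positive definite limit in probability, and, with probability tending
to one, `est` minimizes the GMM criterion over the parameter set `T`. -/
structure IsGMMEstimator {Ω 𝒳 : Type*} [MeasurableSpace Ω] (P : Measure Ω) (X : ℕ → Ω → 𝒳)
    {p q : ℕ} (γ : 𝒳 → EuclideanSpace ℝ (Fin p) → EuclideanSpace ℝ (Fin q))
    (T : Set (EuclideanSpace ℝ (Fin p)))
    (W : (m : ℕ) → (Fin m → 𝒳) → Matrix (Fin q) (Fin q) ℝ)
    (est : (m : ℕ) → (Fin m → 𝒳) → EuclideanSpace ℝ (Fin p))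
    (t : EuclideanSpace ℝ (Fin p)) : Prop where
  mem : t ∈ T
  integrable_moment : Integrable (fun ω => γ (X 0 ω) t) P
  moment_eq_zero : ∫ ω, γ (X 0 ω) t ∂P = 0
  weight_posSemidef : ∀ m x, (W m x).PosSemidef
  weight_limit : ∃ W₀ : Matrix (Fin q) (Fin q) ℝ, W₀.PosDef ∧
    IsConsistentFor P (fun m ω => W m (sample X m ω)) W₀
  minimizes : Tendsto (fun m => P {ω | ¬ (est m (sample X m ω) ∈ T ∧ ∀ s ∈ T,
      gmmObjective γ (W m (sample X m ω)) (sample X m ω) (est m (sample X m ω)) ≤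
        gmmObjective γ (W m (sample X m ω)) (sample X m ω) s)}) atTop (𝓝 0)

/-- The selected coordinates (given by `e`) of a parameter vector. -/
def subvector {p d : ℕ} (e : Fin d ↪ Fin p) (t : EuclideanSpace ℝ (Fin p)) :
    EuclideanSpace ℝ (Fin d) :=
  WithLp.toLp 2 fun a => t (e a)

/-- The studentized estimation error `√m S^{-1/2} (x - t)`. -/
def studentized {d : ℕ} (m : ℕ) (S : Matrix (Fin d) (Fin d) ℝ) (x t : EuclideanSpace ℝ (Fin d)) :
    EuclideanSpace ℝ (Fin d) :=
  √(m : ℝ) • Matrix.toEuclideanCLM (𝕜 := ℝ) (CFC.sqrt S)⁻¹ (x - t)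

/-- Distribution function of the Gaussian-approximation mixture ratio after `n` batches of `k`
observations, computed from the estimators `est` and the covariance estimators `Sest`. -/
def approxCDF {Ω 𝒳 : Type*} [MeasurableSpace Ω] (P : Measure Ω) (X : ℕ → Ω → 𝒳) {d : ℕ}
    (est : (m : ℕ) → (Fin m → 𝒳) → EuclideanSpace ℝ (Fin d))
    (Sest : (m : ℕ) → (Fin m → 𝒳) → Matrix (Fin d) (Fin d) ℝ)
    (g : EuclideanSpace ℝ (Fin d) → ℝ) (t₀ : EuclideanSpace ℝ (Fin d)) (n k : ℕ) (x : ℝ) : ℝ :=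
  P.real {ω | gaussianMixtureRatio g t₀ (est (n * k) (sample X (n * k) ω))
    (((n * k : ℕ) : ℝ)⁻¹ • Sest (n * k) (sample X (n * k) ω)) ≤ x}

/-- Distribution function of the mSPRT after `n` batches of size `k` in the normal batch model:
the batch totals `s 0, …, s (n-1)` are independent with law `N(k t, k S)`, and their likelihood
under the parameter `t'` is the density of `N(k t', k S)`. -/
def batchMSPRTCDF {d : ℕ} (t : EuclideanSpace ℝ (Fin d)) (S : Matrix (Fin d) (Fin d) ℝ)
    (g : EuclideanSpace ℝ (Fin d) → ℝ) (t₀ : EuclideanSpace ℝ (Fin d)) (n k : ℕ) (x : ℝ) : ℝ :=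
  (Measure.pi fun _ : Fin n => multivariateGaussian ((k : ℝ) • t) ((k : ℝ) • S)).real
    {s | mixtureLR (fun t' y => gaussianDensity y ((k : ℝ) • t') ((k : ℝ) • S)) g t₀ s ≤ x}

/-- Pairs `(n, k)` for which the number `n * k` of observations tends to infinity. This contains
the limit in which `n` and `k` both tend to infinity. -/
def manyObservations : Filter (ℕ × ℕ) := comap (fun nk : ℕ × ℕ => nk.1 * nk.2) atTop

/-- Asymptotic equivalence of a family of statistics, with distribution functions `F' i n k`, and
an mSPRT with distribution functions `F i n k`, where `i` runs over the possible true laws: under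
every true law the difference of the distribution functions tends to zero at every threshold. -/
def IsAsymptoticallyEquivalent {I : Type*} (F' F : I → ℕ → ℕ → ℝ → ℝ) : Prop :=
  ∀ i x, Tendsto (fun nk : ℕ × ℕ => F' i nk.1 nk.2 x - F i nk.1 nk.2 x) manyObservations (𝓝 0)

end

/-! The GMM sequence and the exact Gaussian location model `gaussianEstimator` are both instances of
`IsAsymptoticallyNormal` with the same parameter and covariance matrix, so it suffices that the
limit behaviour of the mixture ratio is determined by these two data. The mSPRT belongs to the
Gaussian model because the likelihood ratio of normal batch totals depends only on their sum
(`mixtureLR_gaussian`, `batchMSPRTCDF_eq`).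

Cancelling the normalizing constants writes the ratio as an integral of `exp (m * (q (x - t₀) - q (x
- t)) / 2) * g t`, with `q` the quadratic form of the inverse covariance. If `θ ≠ t₀`, the exponent
is of order `m` near the support point `θ` and the ratio explodes in probability. If `θ = t₀`, the
ratio is `exp (‖studentized error‖ ^ 2 / 2)`, which is bounded in probability, times an integral
that tends to zero when `d ≥ 1`; since the ratio is also positive with probability tending to one,
its distribution function tends to the indicator of `0 < y` at every `y`, including `y = 0`. Hence
both distribution functions have the same pointwise limit (`tendsto_measureReal_ratio_le`).

That limit jumps at zero under the null, so uniformity needs a finer scale. After multiplication by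
`√m ^ d`, Laplace's method at a continuity point of `g` gives the limit law of `exp (‖Z‖ ^ 2 / 2) *
c` with `c > 0` and `Z` standard normal. This law has no atoms, so Pólya's theorem makes the
convergence uniform, and uniformity in the threshold is unaffected by the rescaling. -/

noncomputable section

/-! ### Quadratic forms: coercivity, continuity of the inverse, Gaussian integrability. -/

section QuadraticForm

variable {d : ℕ}

/-- The quadratic form `vᵀ A v`. -/
def quadForm (A : Matrix (Fin d) (Fin d) ℝ) (v : EuclideanSpace ℝ (Fin d)) : ℝ :=
  v.ofLp ⬝ᵥ (A *ᵥ v.ofLp)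

/-- Makes the neighbourhood filters of matrices countably generated, as dominated convergence along
`atTop ×ˢ 𝓝 A₀ ×ˢ 𝓝 t₀` requires. -/
instance : FirstCountableTopology (Matrix (Fin d) (Fin d) ℝ) :=
  inferInstanceAs (FirstCountableTopology (Fin d → Fin d → ℝ))

lemma continuous_quadForm :
    Continuous fun z : Matrix (Fin d) (Fin d) ℝ × EuclideanSpace ℝ (Fin d) =>
      quadForm z.1 z.2 := by
  unfold quadForm
  fun_prop

lemma quadForm_smul (A : Matrix (Fin d) (Fin d) ℝ) (r : ℝ) (v : EuclideanSpace ℝ (Fin d)) :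
    quadForm A (r • v) = r ^ 2 * quadForm A v := by
  simp only [quadForm, WithLp.ofLp_smul, mulVec_smul, smul_dotProduct, dotProduct_smul, smul_eq_mul]
  ring

lemma quadForm_smul_left (A : Matrix (Fin d) (Fin d) ℝ) (r : ℝ) (v : EuclideanSpace ℝ (Fin d)) :
    quadForm (r • A) v = r * quadForm A v := by
  simp only [quadForm, smul_mulVec, dotProduct_smul, smul_eq_mul]

lemma quadForm_zero (A : Matrix (Fin d) (Fin d) ℝ) : quadForm A 0 = 0 := by
  simp [quadForm]

lemma Matrix.PosDef.quadForm_pos {A : Matrix (Fin d) (Fin d) ℝ} (hA : A.PosDef)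
    {v : EuclideanSpace ℝ (Fin d)} (hv : v ≠ 0) : 0 < quadForm A v := by
  have := hA.dotProduct_mulVec_pos (x := v.ofLp) (by simpa using hv)
  simpa [quadForm] using this

/-- Matrices close to a positive definite matrix are uniformly coercive. -/
lemma Matrix.PosDef.eventually_coercive {A₀ : Matrix (Fin d) (Fin d) ℝ} (hA : A₀.PosDef) :
    ∃ c > 0, ∀ᶠ A in 𝓝 A₀, ∀ v : EuclideanSpace ℝ (Fin d), c * ‖v‖ ^ 2 ≤ quadForm A v := by
  have hK : IsCompact (Metric.sphere (0 : EuclideanSpace ℝ (Fin d)) 1) := isCompact_sphere _ _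
  obtain ⟨c, hc, hcK⟩ : ∃ c > 0, ∀ v ∈ Metric.sphere (0 : EuclideanSpace ℝ (Fin d)) 1,
      c < quadForm A₀ v := by
    rcases (Metric.sphere (0 : EuclideanSpace ℝ (Fin d)) 1).eq_empty_or_nonempty with h | h
    -- The unit sphere is empty in dimension zero, where any constant serves.
    · exact ⟨1, one_pos, by simp [h]⟩
    · obtain ⟨v₀, hv₀, hmin⟩ := hK.exists_isMinOn h
        ((continuous_quadForm.comp (Continuous.prodMk_right A₀)).continuousOn)
      have h0 : 0 < quadForm A₀ v₀ := hA.quadForm_pos (by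
        rintro rfl
        simp at hv₀)
      refine ⟨quadForm A₀ v₀ / 2, by positivity, fun v hv => ?_⟩
      have : quadForm A₀ v₀ ≤ quadForm A₀ v := hmin hv
      linarith
  refine ⟨c, hc, ?_⟩
  -- Compactness of the sphere turns the pointwise strict bounds into one neighbourhood of `A₀`;
  -- homogeneity then extends the bound to all vectors.
  have := hK.eventually_forall_of_forall_eventually (x₀ := A₀)
    (P := fun A v => c < quadForm A v)
    (fun v hv => continuous_quadForm.continuousAt.eventually (lt_mem_nhds (hcK v hv)))
  filter_upwards [this] with A hA v
  rcases eq_or_ne v 0 with rfl | hv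
  · simp [quadForm_zero]
  · have hn : 0 < ‖v‖ := norm_pos_iff.2 hv
    have h1 := hA (‖v‖⁻¹ • v) (by simp [norm_smul, hn.ne'])
    rw [quadForm_smul, inv_pow, inv_mul_eq_div, lt_div_iff₀ (by positivity)] at h1
    exact h1.le

/-- By Cramer's rule the inverse is the adjugate over the determinant, both polynomial in the
entries. -/
lemma Matrix.continuousAt_inv {A₀ : Matrix (Fin d) (Fin d) ℝ} (hA : A₀.det ≠ 0) :
    ContinuousAt (fun A : Matrix (Fin d) (Fin d) ℝ => A⁻¹) A₀ := by
  simp only [Matrix.inv_def, Ring.inverse_eq_inv']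
  refine ContinuousAt.smul (ContinuousAt.inv₀ ?_ hA) ?_
  · exact Continuous.continuousAt (by fun_prop)
  · exact Continuous.continuousAt (by fun_prop)

lemma integrable_exp_neg_mul_sq_norm {b : ℝ} (hb : 0 < b) :
    Integrable fun v : EuclideanSpace ℝ (Fin d) => Real.exp (-b * ‖v‖ ^ 2) := by
  have := (GaussianFourier.integrable_cexp_neg_mul_sq_norm_add
    (b := (b : ℂ)) (by simpa using hb) 0 (0 : EuclideanSpace ℝ (Fin d))).re
  refine this.congr (Eventually.of_forall fun v => ?_)
  simp only [inner_zero_left, Complex.ofReal_zero, mul_zero, add_zero]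
  rw [← Complex.exp_ofReal_re]
  simp

end QuadraticForm

/-! ### The mixture ratio as a single exponential integral. -/

section GaussianRatio

variable {d : ℕ}

lemma gaussianDensity_eq (x m : EuclideanSpace ℝ (Fin d)) (S : Matrix (Fin d) (Fin d) ℝ) :
    gaussianDensity x m S =
      (√((2 * Real.pi) ^ d * S.det))⁻¹ * Real.exp (-quadForm S⁻¹ (x - m) / 2) := rfl

lemma gaussianDensity_pos (x m : EuclideanSpace ℝ (Fin d)) {S : Matrix (Fin d) (Fin d) ℝ}
    (hS : 0 < S.det) : 0 < gaussianDensity x m S := by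
  rw [gaussianDensity_eq]
  positivity

lemma gaussianDensity_eq_mul_exp (x m₀ m : EuclideanSpace ℝ (Fin d))
    (S : Matrix (Fin d) (Fin d) ℝ) :
    gaussianDensity x m S =
      gaussianDensity x m₀ S *
        Real.exp ((quadForm S⁻¹ (x - m₀) - quadForm S⁻¹ (x - m)) / 2) := by
  rw [gaussianDensity_eq, gaussianDensity_eq, mul_assoc, ← Real.exp_add]
  congr 2
  ring

lemma inv_smul_of_ne_zero {r : ℝ} (hr : r ≠ 0) {S : Matrix (Fin d) (Fin d) ℝ} (hS : S.det ≠ 0) :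
    (r • S)⁻¹ = r⁻¹ • S⁻¹ := by
  refine Matrix.inv_eq_right_inv ?_
  rw [Matrix.smul_mul, Matrix.mul_smul, smul_smul, mul_inv_cancel₀ hr, one_smul,
    Matrix.mul_nonsing_inv _ (by simpa using hS)]

/-- The Gaussian mixture ratio for the covariance matrix `S / m`, as one integral. -/
lemma gaussianMixtureRatio_eq_integral (g : EuclideanSpace ℝ (Fin d) → ℝ)
    (t₀ x : EuclideanSpace ℝ (Fin d)) {m : ℕ} (hm : m ≠ 0) {S : Matrix (Fin d) (Fin d) ℝ}
    (hS : 0 < S.det) :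
    gaussianMixtureRatio g t₀ x ((m : ℝ)⁻¹ • S) =
      ∫ t, Real.exp (m * (quadForm S⁻¹ (x - t₀) - quadForm S⁻¹ (x - t)) / 2) * g t := by
  have hm' : (0 : ℝ) < m := by exact_mod_cast Nat.pos_of_ne_zero hm
  have hdet : 0 < ((m : ℝ)⁻¹ • S).det := by
    rw [Matrix.det_smul]
    positivity
  have hpos := gaussianDensity_pos x t₀ hdet
  rw [gaussianMixtureRatio, div_eq_iff hpos.ne', mul_comm, ← integral_const_mul]
  refine integral_congr_ae (Eventually.of_forall fun t => ?_)
  simp only []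
  rw [gaussianDensity_eq_mul_exp x t₀ t, inv_smul_of_ne_zero (inv_ne_zero hm'.ne') hS.ne', inv_inv, quadForm_smul_left,
    quadForm_smul_left, mul_assoc, mul_sub]

end GaussianRatio

/-! ### Laplace asymptotics of the integral, jointly in sample size, matrix and centre. -/

section Laplace

variable {d : ℕ} {g : EuclideanSpace ℝ (Fin d) → ℝ} {A₀ : Matrix (Fin d) (Fin d) ℝ}
  {t₀ : EuclideanSpace ℝ (Fin d)}

lemma integrable_exp_mul_of_le {f : EuclideanSpace ℝ (Fin d) → ℝ} (hg : Integrable g)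
    (hf : Continuous f) {C : ℝ} (hC : ∀ t, f t ≤ C) :
    Integrable fun t => Real.exp (f t) * g t :=
  hg.bdd_mul (c := Real.exp C) (hf.rexp.aestronglyMeasurable)
    (Eventually.of_forall fun t => by
      rw [Real.norm_eq_abs, Real.abs_exp]
      exact Real.exp_le_exp.2 (hC t))

lemma continuous_quadForm_sub (A : Matrix (Fin d) (Fin d) ℝ) (x : EuclideanSpace ℝ (Fin d)) :
    Continuous fun t => quadForm A (x - t) := by
  unfold quadForm
  fun_prop

/-- Integrals against exponential tilts of a density are positive. -/
lemma integral_exp_mul_pos {f : EuclideanSpace ℝ (Fin d) → ℝ} (hg : Integrable g)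
    (hg0 : ∀ t, 0 ≤ g t) (hg1 : 0 < ∫ t, g t) (hf : Continuous f) {C : ℝ} (hC : ∀ t, f t ≤ C) :
    0 < ∫ t, Real.exp (f t) * g t := by
  have hi := integrable_exp_mul_of_le hg hf hC
  rw [integral_pos_iff_support_of_nonneg (fun t => by have := hg0 t; positivity) hi]
  rw [integral_pos_iff_support_of_nonneg hg0 hg] at hg1
  convert hg1 using 2
  ext t
  simp [(Real.exp_pos _).ne']

/-- A geometric sequence beats a power of `m`, and `√m ≤ m` once `m ≥ 1`. -/
lemma tendsto_pow_sqrt_mul_exp (d : ℕ) {b : ℝ} (hb : 0 < b) :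
    Tendsto (fun m : ℕ => √(m : ℝ) ^ d * Real.exp (-(m * b))) atTop (𝓝 0) := by
  have h := tendsto_pow_const_mul_const_pow_of_abs_lt_one d (r := Real.exp (-b))
    (by rw [Real.abs_exp]; exact Real.exp_lt_one_iff.2 (by linarith))
  refine squeeze_zero' (Eventually.of_forall fun m => by positivity) ?_ h
  filter_upwards [eventually_ge_atTop 1] with m hm
  have h1 : (1 : ℝ) ≤ m := by exact_mod_cast hm
  rw [← Real.exp_nat_mul, mul_neg]
  gcongr
  exact Real.sqrt_le_self_iff.2 (Or.inr h1)

/-- Away from the diagonal the exponent of the Gaussian weight is at least of order `m`. -/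
lemma eventually_norm_sq_le_quadForm_sub (hA : A₀.PosDef) :
    ∃ c > 0, ∀ δ > 0, ∀ᶠ z in (atTop : Filter ℕ) ×ˢ 𝓝 A₀ ×ˢ 𝓝 t₀,
      ∀ t, δ ≤ dist t t₀ → c * δ ^ 2 ≤ quadForm z.2.1 (z.2.2 - t) := by
  obtain ⟨c, hc, h⟩ := hA.eventually_coercive
  -- The moving centre stays within `δ / 2` of `t₀`, so `t` is at distance at least `δ / 2` from it;
  -- squaring costs the factor 4.
  refine ⟨c / 4, by positivity, fun δ hδ => ?_⟩
  have h1 : ∀ᶠ z in (atTop : Filter ℕ) ×ˢ 𝓝 A₀ ×ˢ 𝓝 t₀,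
      ∀ v : EuclideanSpace ℝ (Fin d), c * ‖v‖ ^ 2 ≤ quadForm z.2.1 v :=
    (tendsto_fst.comp tendsto_snd).eventually h
  have h2 : ∀ᶠ z in (atTop : Filter ℕ) ×ˢ 𝓝 A₀ ×ˢ 𝓝 t₀, dist z.2.2 t₀ < δ / 2 :=
    (tendsto_snd.comp tendsto_snd).eventually (Metric.ball_mem_nhds _ (by positivity))
  filter_upwards [h1, h2] with z h1 h2 t ht
  refine le_trans ?_ (h1 _)
  have h3 : δ / 2 ≤ ‖z.2.2 - t‖ := by
    rw [← dist_eq_norm]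
    have := dist_triangle t z.2.2 t₀
    linarith [dist_comm z.2.2 t]
  have h4 : (δ / 2) ^ 2 ≤ ‖z.2.2 - t‖ ^ 2 := by gcongr
  nlinarith

lemma eventually_quadForm_nonneg (hA : A₀.PosDef) :
    ∀ᶠ z in (atTop : Filter ℕ) ×ˢ 𝓝 A₀ ×ˢ 𝓝 t₀, ∀ v, 0 ≤ quadForm z.2.1 v := by
  obtain ⟨c, hc, h⟩ := hA.eventually_coercive
  filter_upwards [(tendsto_fst.comp tendsto_snd).eventually h] with z hz v
  exact le_trans (by positivity) (hz v)

/-- Gaussian averages of an integrable function around a point lose all mass as the Gaussian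
weight concentrates (without normalization). -/
lemma tendsto_integral_exp_neg_quadForm_zero [NeZero d] (hg : Integrable g) (hA : A₀.PosDef) :
    Tendsto (fun z : ℕ × Matrix (Fin d) (Fin d) ℝ × EuclideanSpace ℝ (Fin d) =>
      ∫ t, Real.exp (-(z.1 * quadForm z.2.1 (z.2.2 - t) / 2)) * g t)
      (atTop ×ˢ 𝓝 A₀ ×ˢ 𝓝 t₀) (𝓝 0) := by
  rw [← integral_zero (EuclideanSpace ℝ (Fin d)) ℝ]
  refine tendsto_integral_filter_of_dominated_convergence (fun t => ‖g t‖) ?_ ?_ hg.norm ?_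
  · refine Eventually.of_forall fun z => ?_
    refine AEStronglyMeasurable.mul ?_ hg.1
    refine Continuous.aestronglyMeasurable ?_
    have := continuous_quadForm_sub z.2.1 z.2.2
    fun_prop
  · filter_upwards [eventually_quadForm_nonneg hA] with z hz
    refine Eventually.of_forall fun t => ?_
    rw [norm_mul, Real.norm_eq_abs, Real.abs_exp]
    refine mul_le_of_le_one_left (norm_nonneg _) (Real.exp_le_one_iff.2 ?_)
    have := hz (z.2.2 - t)
    have : 0 ≤ (z.1 : ℝ) * quadForm z.2.1 (z.2.2 - t) / 2 := by positivity
    linarith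
  -- For `d ≥ 1` the point `t₀` is Lebesgue null, and at any other `t` the exponent tends to minus
  -- infinity.
  · have : Nonempty (Fin d) := ⟨⟨0, Nat.pos_of_ne_zero (NeZero.ne d)⟩⟩
    filter_upwards [compl_mem_ae_iff.2 (measure_singleton t₀)] with t ht
    have hne : t₀ - t ≠ 0 := sub_ne_zero.2 (Ne.symm ht)
    have h1 : Tendsto (fun z : ℕ × Matrix (Fin d) (Fin d) ℝ × EuclideanSpace ℝ (Fin d) =>
        quadForm z.2.1 (z.2.2 - t)) (atTop ×ˢ 𝓝 A₀ ×ˢ 𝓝 t₀) (𝓝 (quadForm A₀ (t₀ - t))) := by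
      have hc : Continuous fun z : Matrix (Fin d) (Fin d) ℝ × EuclideanSpace ℝ (Fin d) =>
          quadForm z.1 (z.2 - t) := by
        unfold quadForm
        fun_prop
      have := hc.tendsto (A₀, t₀)
      rw [nhds_prod_eq] at this
      exact this.comp tendsto_snd
    have h2 : Tendsto (fun z : ℕ × Matrix (Fin d) (Fin d) ℝ × EuclideanSpace ℝ (Fin d) =>
        (z.1 : ℝ)) (atTop ×ˢ 𝓝 A₀ ×ˢ 𝓝 t₀) atTop :=
      tendsto_natCast_atTop_atTop.comp tendsto_fst
    have h3 := (h2.atTop_mul_pos (hA.quadForm_pos hne) h1).atTop_div_const (two_pos)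
    have h4 := (Real.tendsto_exp_neg_atTop_nhds_zero.comp h3).mul_const (g t)
    simpa using h4

/-- Rescaling of a Gaussian average. -/
lemma sqrt_pow_mul_integral_exp_neg_quadForm (f : EuclideanSpace ℝ (Fin d) → ℝ) {m : ℕ}
    (hm : m ≠ 0) (A : Matrix (Fin d) (Fin d) ℝ) (x : EuclideanSpace ℝ (Fin d)) :
    √(m : ℝ) ^ d * ∫ t, Real.exp (-(m * quadForm A (x - t) / 2)) * f t =
      ∫ v, Real.exp (-(quadForm A v / 2)) * f (x - (√(m : ℝ))⁻¹ • v) := by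
  have hm' : (0 : ℝ) < m := by exact_mod_cast Nat.pos_of_ne_zero hm
  have h1 : ∫ t, Real.exp (-(m * quadForm A (x - t) / 2)) * f t =
      ∫ u, Real.exp (-(m * quadForm A u / 2)) * f (x - u) := by
    rw [← integral_sub_left_eq_self _ volume x]
    simp
  rw [h1]
  have h2 := Measure.integral_comp_smul (volume : Measure (EuclideanSpace ℝ (Fin d)))
    (fun u => Real.exp (-(m * quadForm A u / 2)) * f (x - u)) (√(m : ℝ))⁻¹
  have hs : (0 : ℝ) < √(m : ℝ) := Real.sqrt_pos.2 hm'
  rw [finrank_euclideanSpace_fin, inv_pow, inv_inv, abs_of_pos (by positivity), smul_eq_mul] at h2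
  rw [← h2]
  refine integral_congr_ae (Eventually.of_forall fun v => ?_)
  simp only []
  rw [quadForm_smul, inv_pow, Real.sq_sqrt hm'.le, mul_inv_cancel_left₀ hm'.ne']

/-- The normalized Gaussian averages of a density around a point of continuity. -/
lemma tendsto_sqrt_pow_mul_integral_exp_neg_quadForm (hg : Integrable g) (hA : A₀.PosDef)
    (hcont : ContinuousAt g t₀) :
    Tendsto (fun z : ℕ × Matrix (Fin d) (Fin d) ℝ × EuclideanSpace ℝ (Fin d) =>
      √(z.1 : ℝ) ^ d * ∫ t, Real.exp (-(z.1 * quadForm z.2.1 (z.2.2 - t) / 2)) * g t)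
      (atTop ×ˢ 𝓝 A₀ ×ˢ 𝓝 t₀) (𝓝 (∫ v, Real.exp (-(quadForm A₀ v / 2)) * g t₀)) := by
  -- Continuity bounds `g` only near `t₀`. The part of `g` in this ball is treated by rescaling and
  -- dominated convergence, the rest by exponential decay.
  obtain ⟨δ, hδ, hbd⟩ : ∃ δ > 0, ∀ t ∈ Metric.ball t₀ δ, ‖g t‖ ≤ ‖g t₀‖ + 1 := by
    have : ∀ᶠ t in 𝓝 t₀, ‖g t‖ < ‖g t₀‖ + 1 :=
      hcont.norm.eventually (gt_mem_nhds (by linarith))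
    obtain ⟨δ, hδ, h⟩ := Metric.eventually_nhds_iff_ball.1 this
    exact ⟨δ, hδ, fun t ht => (h t ht).le⟩
  set B := Metric.ball t₀ δ with hB
  have hBm : MeasurableSet B := Metric.isOpen_ball.measurableSet
  have hgB := hg.indicator hBm
  have hgBc := hg.indicator hBm.compl
  have hm1 : ∀ᶠ z in (atTop : Filter ℕ) ×ˢ 𝓝 A₀ ×ˢ 𝓝 t₀, z.1 ≠ 0 :=
    tendsto_fst.eventually (eventually_ne_atTop 0)
  have hnear : Tendsto (fun z : ℕ × Matrix (Fin d) (Fin d) ℝ × EuclideanSpace ℝ (Fin d) =>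
      √(z.1 : ℝ) ^ d * ∫ t, Real.exp (-(z.1 * quadForm z.2.1 (z.2.2 - t) / 2)) * B.indicator g t)
      (atTop ×ˢ 𝓝 A₀ ×ˢ 𝓝 t₀) (𝓝 (∫ v, Real.exp (-(quadForm A₀ v / 2)) * g t₀)) := by
    have heq : ∀ᶠ z in (atTop : Filter ℕ) ×ˢ 𝓝 A₀ ×ˢ 𝓝 t₀,
        (∫ v, Real.exp (-(quadForm z.2.1 v / 2)) *
          B.indicator g (z.2.2 - (√(z.1 : ℝ))⁻¹ • v)) =
        √(z.1 : ℝ) ^ d *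
          ∫ t, Real.exp (-(z.1 * quadForm z.2.1 (z.2.2 - t) / 2)) * B.indicator g t := by
      filter_upwards [hm1] with z hz
      exact (sqrt_pow_mul_integral_exp_neg_quadForm _ hz _ _).symm
    refine Tendsto.congr' heq ?_
    obtain ⟨c, hc, hco⟩ := hA.eventually_coercive
    -- Coercivity uniform near `A₀` provides one Gaussian majorant for all nearby matrices.
    refine tendsto_integral_filter_of_dominated_convergence
      (fun v => Real.exp (-(c / 2) * ‖v‖ ^ 2) * (‖g t₀‖ + 1)) ?_ ?_
      ((integrable_exp_neg_mul_sq_norm (by positivity)).mul_const _) ?_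
    · filter_upwards [hm1] with z hz
      have hm' : (0 : ℝ) < z.1 := by exact_mod_cast Nat.pos_of_ne_zero hz
      refine AEStronglyMeasurable.mul ?_ ?_
      · refine Continuous.aestronglyMeasurable ?_
        have : Continuous (quadForm z.2.1) := by
          unfold quadForm
          fun_prop
        fun_prop
      · exact ((hgB.comp_sub_left z.2.2).comp_smul (R := (√(z.1 : ℝ))⁻¹) (by positivity)).1
    · filter_upwards [(tendsto_fst.comp tendsto_snd).eventually hco] with z hz
      refine Eventually.of_forall fun v => ?_
      rw [norm_mul, Real.norm_eq_abs, Real.abs_exp]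
      gcongr
      · have : c * ‖v‖ ^ 2 ≤ quadForm z.2.1 v := hz v
        linarith
      · by_cases h : z.2.2 - (√(z.1 : ℝ))⁻¹ • v ∈ B
        · rw [Set.indicator_of_mem h]
          exact hbd _ h
        · rw [Set.indicator_of_notMem h, norm_zero]
          positivity
    · refine Eventually.of_forall fun v => ?_
      have h1 : Tendsto (fun z : ℕ × Matrix (Fin d) (Fin d) ℝ × EuclideanSpace ℝ (Fin d) =>
          quadForm z.2.1 v) (atTop ×ˢ 𝓝 A₀ ×ˢ 𝓝 t₀) (𝓝 (quadForm A₀ v)) :=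
        ((continuous_quadForm.comp (Continuous.prodMk_left v)).tendsto A₀).comp
          (tendsto_fst.comp tendsto_snd)
      have h2 : Tendsto (fun z : ℕ × Matrix (Fin d) (Fin d) ℝ × EuclideanSpace ℝ (Fin d) =>
          z.2.2 - (√(z.1 : ℝ))⁻¹ • v) (atTop ×ˢ 𝓝 A₀ ×ˢ 𝓝 t₀) (𝓝 t₀) := by
        have h3 : Tendsto (fun z : ℕ × Matrix (Fin d) (Fin d) ℝ × EuclideanSpace ℝ (Fin d) =>
            (√(z.1 : ℝ))⁻¹) (atTop ×ˢ 𝓝 A₀ ×ˢ 𝓝 t₀) (𝓝 0) :=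
          (tendsto_inv_atTop_zero.comp
            (Real.tendsto_sqrt_atTop.comp tendsto_natCast_atTop_atTop)).comp tendsto_fst
        have h4 : Tendsto (fun z : ℕ × Matrix (Fin d) (Fin d) ℝ × EuclideanSpace ℝ (Fin d) =>
            z.2.2) (atTop ×ˢ 𝓝 A₀ ×ˢ 𝓝 t₀) (𝓝 t₀) := tendsto_snd.comp tendsto_snd
        simpa using h4.sub (h3.smul_const v)
      have h5 : ContinuousAt (B.indicator g) t₀ :=
        hcont.congr (by
          filter_upwards [Metric.ball_mem_nhds t₀ hδ] with t ht
          rw [Set.indicator_of_mem ht])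
      have h6 : Tendsto (fun z : ℕ × Matrix (Fin d) (Fin d) ℝ × EuclideanSpace ℝ (Fin d) =>
          B.indicator g (z.2.2 - (√(z.1 : ℝ))⁻¹ • v)) (atTop ×ˢ 𝓝 A₀ ×ˢ 𝓝 t₀) (𝓝 (g t₀)) := by
        have := h5.tendsto.comp h2
        rwa [Set.indicator_of_mem (Metric.mem_ball_self hδ)] at this
      exact ((Real.continuous_exp.tendsto _).comp (h1.div_const 2).neg).mul h6
  have hfar : Tendsto (fun z : ℕ × Matrix (Fin d) (Fin d) ℝ × EuclideanSpace ℝ (Fin d) =>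
      √(z.1 : ℝ) ^ d * ∫ t, Real.exp (-(z.1 * quadForm z.2.1 (z.2.2 - t) / 2)) * Bᶜ.indicator g t)
      (atTop ×ˢ 𝓝 A₀ ×ˢ 𝓝 t₀) (𝓝 0) := by
    -- Outside the ball the weight is at most `exp (-(m * (c * δ ^ 2 / 2)))`, which absorbs `√m ^
    -- d`; only integrability of `g` is needed there.
    obtain ⟨c, hc, hco⟩ := eventually_norm_sq_le_quadForm_sub (t₀ := t₀) hA
    have hlim := ((tendsto_pow_sqrt_mul_exp d (b := c * δ ^ 2 / 2) (by positivity)).mul_const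
      (∫ t, ‖Bᶜ.indicator g t‖)).comp (tendsto_fst (f := (atTop : Filter ℕ)) (g := 𝓝 A₀ ×ˢ 𝓝 t₀))
    rw [zero_mul] at hlim
    refine squeeze_zero_norm' ?_ hlim
    filter_upwards [hco δ hδ] with z hz
    simp only [Function.comp_apply]
    rw [norm_mul, Real.norm_of_nonneg (by positivity : (0 : ℝ) ≤ √(z.1 : ℝ) ^ d), mul_assoc,
      ← integral_const_mul]
    gcongr
    refine (norm_integral_le_integral_norm _).trans ?_
    refine integral_mono_of_nonneg (Eventually.of_forall fun t => norm_nonneg _)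
      (hgBc.norm.const_mul _) (Eventually.of_forall fun t => ?_)
    simp only [norm_mul, Real.norm_eq_abs, Real.abs_exp]
    by_cases h : t ∈ Bᶜ
    · have h1 := hz t (by simpa [hB] using h)
      gcongr
      rw [mul_div_assoc _ (quadForm _ _)]
      gcongr
    · rw [Set.indicator_of_notMem h]
      simp
  have hsum := hnear.add hfar
  rw [add_zero] at hsum
  refine hsum.congr' ?_
  filter_upwards [eventually_quadForm_nonneg hA] with z hz
  have hf : Continuous fun t => -(z.1 * quadForm z.2.1 (z.2.2 - t) / 2) := by
    have := continuous_quadForm_sub z.2.1 z.2.2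
    fun_prop
  have hle : ∀ t, -(z.1 * quadForm z.2.1 (z.2.2 - t) / 2) ≤ 0 := fun t => by
    have := hz (z.2.2 - t)
    have : 0 ≤ (z.1 : ℝ) * quadForm z.2.1 (z.2.2 - t) / 2 := by positivity
    linarith
  rw [← mul_add, ← integral_add (integrable_exp_mul_of_le hgB hf hle)
    (integrable_exp_mul_of_le hgBc hf hle)]
  congr 2 with t
  rw [← mul_add, Set.indicator_self_add_compl_apply]

/-- The tilted integrals explode if the centre is a support point different from `t₀`. -/
lemma tendsto_integral_exp_quadForm_sub_atTop {θ : EuclideanSpace ℝ (Fin d)} (hg : Integrable g)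
    (hg0 : ∀ t, 0 ≤ g t) (hA : A₀.PosDef) (hne : θ ≠ t₀) (hsupp : ∀ U ∈ 𝓝 θ, 0 < ∫ t in U, g t) :
    Tendsto (fun z : ℕ × Matrix (Fin d) (Fin d) ℝ × EuclideanSpace ℝ (Fin d) =>
      ∫ t, Real.exp (z.1 * (quadForm z.2.1 (z.2.2 - t₀) - quadForm z.2.1 (z.2.2 - t)) / 2) * g t)
      (atTop ×ˢ 𝓝 A₀ ×ˢ 𝓝 θ) atTop := by
  have hq : 0 < quadForm A₀ (θ - t₀) := hA.quadForm_pos (sub_ne_zero.2 hne)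
  -- At the limit matrix and centre, and at `t = θ`, the gap of the forms is `2 * c`; hence it
  -- exceeds `c` on a whole neighbourhood, which carries positive `g`-mass.
  set c := quadForm A₀ (θ - t₀) / 2 with hc
  have hev : ∀ᶠ z in 𝓝 ((A₀, θ), θ),
      c < quadForm z.1.1 (z.1.2 - t₀) - quadForm z.1.1 (z.1.2 - z.2) := by
    have hcont : Continuous fun z : (Matrix (Fin d) (Fin d) ℝ × EuclideanSpace ℝ (Fin d)) ×
        EuclideanSpace ℝ (Fin d) =>
        quadForm z.1.1 (z.1.2 - t₀) - quadForm z.1.1 (z.1.2 - z.2) := by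
      unfold quadForm
      fun_prop
    refine hcont.continuousAt.eventually (lt_mem_nhds ?_)
    simp only [sub_self, quadForm_zero, sub_zero]
    linarith
  rw [nhds_prod_eq, eventually_prod_iff] at hev
  obtain ⟨p, hp, q, hqv, h⟩ := hev
  rw [nhds_prod_eq] at hp
  obtain ⟨U, hUq, hUo, hUθ⟩ := eventually_nhds_iff.1 hqv
  have hI := hsupp U (hUo.mem_nhds hUθ)
  have hlim : Tendsto (fun m : ℕ => Real.exp (m * c / 2) * ∫ t in U, g t) atTop atTop := by
    refine Tendsto.atTop_mul_const hI (Real.tendsto_exp_atTop.comp ?_)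
    exact (tendsto_natCast_atTop_atTop.atTop_mul_const (by positivity)).atTop_div_const two_pos
  refine tendsto_atTop_mono' _ ?_ (hlim.comp tendsto_fst)
  filter_upwards [tendsto_snd.eventually hp, eventually_quadForm_nonneg hA] with z hz hnn
  have hf : Continuous fun t =>
      (z.1 : ℝ) * (quadForm z.2.1 (z.2.2 - t₀) - quadForm z.2.1 (z.2.2 - t)) / 2 := by
    have := continuous_quadForm_sub z.2.1 z.2.2
    fun_prop
  have hint := integrable_exp_mul_of_le hg hf (C := z.1 * quadForm z.2.1 (z.2.2 - t₀) / 2)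
    (fun t => by
      have := hnn (z.2.2 - t)
      gcongr
      linarith)
  simp only [Function.comp_apply]
  rw [← integral_const_mul]
  refine le_trans ?_ (setIntegral_le_integral hint (s := U) (Eventually.of_forall fun t => ?_))
  · refine setIntegral_mono_on (hg.integrableOn.const_mul _) hint.integrableOn hUo.measurableSet
      fun t ht => ?_
    have := h hz (hUq t ht)
    have := hg0 t
    gcongr
  · have := hg0 t
    positivity

end Laplace

/-! ### Absolute continuity of the standard Gaussian measure. -/

section StandardGaussian

variable {E : Type*} [NormedAddCommGroup E] [InnerProductSpace ℝ E] [FiniteDimensional ℝ E]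
  [MeasurableSpace E] [BorelSpace E]

/-- The standard Gaussian measure has a density. -/
lemma stdGaussian_eq_withDensity :
    stdGaussian E = volume.withDensity fun v => ENNReal.ofReal
      ((∫ u : E, Real.exp (-(1 / 2) * ‖u‖ ^ 2))⁻¹ * Real.exp (-(1 / 2) * ‖v‖ ^ 2)) := by
  set K := ∫ u : E, Real.exp (-(1 / 2) * ‖u‖ ^ 2) with hK
  have hhalf : (0 : ℝ) < 1 / 2 := by norm_num
  have hint : Integrable fun v : E => Real.exp (-(1 / 2) * ‖v‖ ^ 2) := by
    have := (GaussianFourier.integrable_cexp_neg_mul_sq_norm_add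
      (b := ((1 / 2 : ℝ) : ℂ)) (by simp) 0 (0 : E)).re
    refine this.congr (Eventually.of_forall fun v => ?_)
    simp only [inner_zero_left, Complex.ofReal_zero, mul_zero, add_zero]
    rw [← Complex.exp_ofReal_re]
    simp
  have hKpos : 0 < K := integral_exp_pos hint
  have hKc : (K : ℂ) =
      ((Real.pi : ℂ) / ((1 / 2 : ℝ) : ℂ)) ^ (Module.finrank ℝ E / 2 : ℂ) := by
    rw [← GaussianFourier.integral_cexp_neg_mul_sq_norm (V := E) (by simp), hK,
      ← integral_complex_ofReal]
    refine integral_congr_ae (Eventually.of_forall fun v => ?_)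
    simp
  have hmeas : Measurable fun v : E =>
      ENNReal.ofReal (K⁻¹ * Real.exp (-(1 / 2) * ‖v‖ ^ 2)) := by fun_prop
  have hfin : IsFiniteMeasure (volume.withDensity fun v : E =>
      ENNReal.ofReal (K⁻¹ * Real.exp (-(1 / 2) * ‖v‖ ^ 2))) :=
    isFiniteMeasure_withDensity_ofReal (hint.const_mul _).2
  -- Both measures are finite, so it is enough to match characteristic functions; `hKc` identifies
  -- `K` with the constant in the Gaussian Fourier integral.
  refine Measure.ext_of_charFun ?_
  ext t
  rw [charFun_stdGaussian, charFun_apply, integral_withDensity_eq_integral_toReal_smul hmeas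
    (Eventually.of_forall fun _ => ENNReal.ofReal_lt_top)]
  have h1 : ∀ v : E, (ENNReal.ofReal (K⁻¹ * Real.exp (-(1 / 2) * ‖v‖ ^ 2))).toReal •
      Complex.exp ((inner ℝ v t : ℝ) * Complex.I) =
      (K : ℂ)⁻¹ * Complex.exp (-((1 / 2 : ℝ) : ℂ) * ‖v‖ ^ 2 + Complex.I * (inner ℝ t v : ℝ)) := by
    intro v
    rw [ENNReal.toReal_ofReal (by positivity), Complex.real_smul, Complex.exp_add,
      real_inner_comm, mul_comm Complex.I]
    push_cast
    ring
  simp_rw [h1]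
  rw [integral_const_mul, GaussianFourier.integral_cexp_neg_mul_sq_norm_add (by simp), ← hKc,
    inv_mul_cancel_left₀ (by exact_mod_cast hKpos.ne')]
  congr 1
  rw [Complex.I_sq]
  push_cast
  ring

lemma stdGaussian_absolutelyContinuous : stdGaussian E ≪ volume := by
  rw [stdGaussian_eq_withDensity]
  exact withDensity_absolutelyContinuous _ _

lemma stdGaussian_sphere [Nontrivial E] (r : ℝ) :
    stdGaussian E (Metric.sphere 0 r) = 0 :=
  stdGaussian_absolutelyContinuous (Measure.addHaar_sphere volume 0 r)

end StandardGaussian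

/-! ### Convergence in probability as convergence along a filter. -/

section InProbability

variable {Ω : Type*} [MeasurableSpace Ω]

/-- The filter of subsets of `ℕ × Ω` whose section at `m` has probability tending to one.
Convergence in probability to a constant is convergence along this filter. -/
def inProbability (P : Measure Ω) : Filter (ℕ × Ω) where
  sets := {V | Tendsto (fun m => P {ω | (m, ω) ∉ V}) atTop (𝓝 0)}
  univ_sets := by simp
  sets_of_superset {V W} hV hVW :=
    tendsto_of_tendsto_of_tendsto_of_le_of_le tendsto_const_nhds hV (fun _ => zero_le)
      fun m => measure_mono fun ω hω h => hω (hVW h)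
  inter_sets {V W} hV hW := by
    have h : Tendsto (fun m => P {ω | (m, ω) ∉ V} + P {ω | (m, ω) ∉ W}) atTop (𝓝 (0 + 0)) :=
      Tendsto.add hV hW
    rw [add_zero] at h
    refine tendsto_of_tendsto_of_tendsto_of_le_of_le tendsto_const_nhds h (fun _ => zero_le)
      fun m => (measure_mono ?_).trans (measure_union_le _ _)
    intro ω hω
    by_contra hcon
    simp only [Set.mem_union, Set.mem_ofPred_eq, not_or, not_not] at hcon
    exact hω ⟨hcon.1, hcon.2⟩

variable {P : Measure Ω}

lemma eventually_inProbability {p : ℕ × Ω → Prop} :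
    (∀ᶠ z in inProbability P, p z) ↔ Tendsto (fun m => P {ω | ¬ p (m, ω)}) atTop (𝓝 0) :=
  Iff.rfl

lemma tendsto_fst_inProbability : Tendsto Prod.fst (inProbability P) atTop := by
  intro s hs
  refine tendsto_const_nhds.congr' ?_
  filter_upwards [hs] with m hm
  simp [Set.mem_preimage, hm]

lemma eventually_fst_ne_zero : ∀ᶠ z in inProbability P, z.1 ≠ 0 :=
  tendsto_fst_inProbability.eventually (eventually_ne_atTop 0)

/-- This translation lets continuity and squeeze arguments for ordinary limits apply verbatim to
convergence in probability. -/
lemma tendstoInMeasure_const_iff {F : Type*} [PseudoMetricSpace F] {f : ℕ → Ω → F} {c : F} :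
    TendstoInMeasure P f atTop (fun _ => c) ↔
      Tendsto (fun z : ℕ × Ω => f z.1 z.2) (inProbability P) (𝓝 c) := by
  rw [tendstoInMeasure_iff_dist, Metric.tendsto_nhds]
  simp only [eventually_inProbability, not_lt]

lemma isConsistentFor_iff {r : ℕ} {M : ℕ → Ω → Matrix (Fin r) (Fin r) ℝ}
    {A : Matrix (Fin r) (Fin r) ℝ} :
    IsConsistentFor P M A ↔ Tendsto (fun z : ℕ × Ω => M z.1 z.2) (inProbability P) (𝓝 A) := by
  unfold IsConsistentFor
  simp_rw [tendstoInMeasure_const_iff]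
  exact ⟨fun h => tendsto_pi_nhds.2 fun a => tendsto_pi_nhds.2 fun b => h a b,
    fun h a b => tendsto_pi_nhds.1 (tendsto_pi_nhds.1 h a) b⟩

/-- Convergence of probabilities to zero, for real-valued probabilities. -/
lemma tendsto_measureReal_zero [IsFiniteMeasure P] {p : ℕ × Ω → Prop}
    (h : ∀ᶠ z in inProbability P, ¬ p z) :
    Tendsto (fun m => P.real {ω | p (m, ω)}) atTop (𝓝 0) := by
  rw [eventually_inProbability] at h
  simp only [not_not] at h
  simpa [Measure.real, Function.comp_def] using (ENNReal.tendsto_toReal ENNReal.zero_ne_top).comp h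

variable {Ω' : Type*} [MeasurableSpace Ω'] {P' : Measure Ω'} [IsProbabilityMeasure P]
  [IsProbabilityMeasure P']

/-- Convergence in distribution implies convergence of the distribution functions at the points
that are not atoms of the limit. -/
lemma tendsto_measureReal_le_of_tendstoInDistribution {Y : ℕ → Ω → ℝ} {Z : Ω' → ℝ}
    (h : TendstoInDistribution Y atTop Z (fun _ => P) P') {x : ℝ} (hx : P' {ω | Z ω = x} = 0) :
    Tendsto (fun m => P.real {ω | Y m ω ≤ x}) atTop (𝓝 (P'.real {ω | Z ω ≤ x})) := by
  have h1 := ProbabilityMeasure.tendsto_measure_of_null_frontier_of_tendsto' h.tendsto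
    (E := Set.Iic x) (by
      rw [frontier_Iic, ProbabilityMeasure.coe_mk, Measure.map_apply_of_aemeasurable
        h.aemeasurable_limit (measurableSet_singleton x)]
      exact hx)
  have h2 : ∀ m, P.map (Y m) (Set.Iic x) = P {ω | Y m ω ≤ x} := fun m =>
    Measure.map_apply_of_aemeasurable (h.forall_aemeasurable m) measurableSet_Iic
  have h3 : P'.map Z (Set.Iic x) = P' {ω | Z ω ≤ x} :=
    Measure.map_apply_of_aemeasurable h.aemeasurable_limit measurableSet_Iic
  simp only [ProbabilityMeasure.coe_mk, h2, h3] at h1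
  exact (ENNReal.tendsto_toReal (measure_ne_top _ _)).comp h1

/-- If `Y` converges in distribution and `C` converges to zero in probability, then a product
`ψ(Y) * C` with `ψ` continuous converges to zero in probability. -/
lemma tendsto_mul_zero_of_tendstoInDistribution {E : Type*} [NormedAddCommGroup E]
    [SecondCountableTopology E] [MeasurableSpace E] [BorelSpace E] {Y : ℕ → Ω → E} {Z : Ω' → E}
    (h : TendstoInDistribution Y atTop Z (fun _ => P) P') {C : ℕ → Ω → ℝ}
    (hCm : ∀ m, AEMeasurable (C m) P)
    (hC : Tendsto (fun z : ℕ × Ω => C z.1 z.2) (inProbability P) (𝓝 0)) {ψ : E → ℝ}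
    (hψ : Continuous ψ) :
    Tendsto (fun z : ℕ × Ω => ψ (Y z.1 z.2) * C z.1 z.2) (inProbability P) (𝓝 0) := by
  have h1 := h.continuous_comp_prodMk_of_tendstoInMeasure_const
    (g := fun z : E × ℝ => |ψ z.1 * z.2|) (by fun_prop) (tendstoInMeasure_const_iff.2 hC) hCm
  rw [tendsto_zero_iff_abs_tendsto_zero, Metric.tendsto_nhds]
  intro ε hε
  -- The limit variable is constantly zero, so the positive threshold `ε / 2` is not an atom;
  -- halving yields the strict inequality needed at the end.
  have h2 := tendsto_measureReal_le_of_tendstoInDistribution h1 (x := ε / 2) (by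
    simp [(half_pos hε).ne])
  have h3 : P'.real {ω | |ψ (Z ω) * 0| ≤ ε / 2} = 1 := by
    simp [(half_pos hε).le]
  rw [h3] at h2
  have h4 : Tendsto (fun m => P.real {ω | ¬ |ψ (Y m ω) * C m ω| ≤ ε / 2}) atTop (𝓝 0) := by
    have := h2.const_sub 1
    rw [sub_self] at this
    refine this.congr fun m => ?_
    have hn : NullMeasurableSet {ω | |ψ (Y m ω) * C m ω| ≤ ε / 2} P :=
      nullMeasurableSet_le (h1.forall_aemeasurable m) aemeasurable_const
    rw [← probReal_compl_eq_one_sub₀ hn]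
    rfl
  rw [eventually_inProbability]
  have h5 : Tendsto (fun m => P {ω | ¬ |ψ (Y m ω) * C m ω| ≤ ε / 2}) atTop (𝓝 0) := by
    have := ENNReal.tendsto_ofReal h4
    simpa [ofReal_measureReal] using this
  refine tendsto_of_tendsto_of_tendsto_of_le_of_le tendsto_const_nhds h5 (fun _ => zero_le)
    fun m => measure_mono fun ω hω hle => hω ?_
  simp only [Function.comp_apply, dist_zero_right, Real.norm_eq_abs, abs_abs]
  linarith

end InProbability

/-! ### The squared norm of the studentized error. -/

section Studentized

variable {d : ℕ}

lemma transpose_sqrt (S : Matrix (Fin d) (Fin d) ℝ) : (CFC.sqrt S)ᵀ = CFC.sqrt S := by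
  have h : (CFC.sqrt S).IsHermitian := (CFC.sqrt_nonneg S).isSelfAdjoint
  simpa [Matrix.IsHermitian, Matrix.conjTranspose_eq_transpose_of_trivial] using h

lemma norm_sq_toEuclideanCLM (B : Matrix (Fin d) (Fin d) ℝ) (v : EuclideanSpace ℝ (Fin d)) :
    ‖Matrix.toEuclideanCLM (𝕜 := ℝ) B v‖ ^ 2 = quadForm (Bᵀ * B) v := by
  rw [← real_inner_self_eq_norm_sq, inner_toEuclideanCLM, ofLp_toEuclideanCLM, quadForm,
    ← mulVec_mulVec, mulVec_transpose, dotProduct_comm, dotProduct_comm v.ofLp, dotProduct_mulVec]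

/-- The square root is symmetric and squares to `S`. Singular `S` is covered too, since
`Matrix.mul_inv_rev` holds without invertibility. -/
lemma norm_sq_studentized (m : ℕ) {S : Matrix (Fin d) (Fin d) ℝ} (hS : S.PosSemidef)
    (x t : EuclideanSpace ℝ (Fin d)) :
    ‖studentized m S x t‖ ^ 2 = m * quadForm S⁻¹ (x - t) := by
  rw [studentized, norm_smul, mul_pow, norm_sq_toEuclideanCLM, Real.norm_eq_abs, sq_abs,
    Real.sq_sqrt (Nat.cast_nonneg m), transpose_nonsing_inv, transpose_sqrt, ← Matrix.mul_inv_rev,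
    CFC.sqrt_mul_sqrt_self S hS.nonneg]

end Studentized

/-! ### Measurability of the mixture ratio. -/

section Measurability

variable {α : Type*} [MeasurableSpace α] {d : ℕ}

lemma measurable_det {S : α → Matrix (Fin d) (Fin d) ℝ}
    (hS : ∀ a b, Measurable fun ω => S ω a b) : Measurable fun ω => (S ω).det := by
  simp only [Matrix.det_apply]
  fun_prop

lemma measurable_inv_apply {S : α → Matrix (Fin d) (Fin d) ℝ}
    (hS : ∀ a b, Measurable fun ω => S ω a b) (a b : Fin d) :
    Measurable fun ω => (S ω)⁻¹ a b := by
  simp only [Matrix.inv_def, Ring.inverse_eq_inv', Matrix.smul_apply, smul_eq_mul,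
    Matrix.adjugate_apply]
  refine (measurable_det hS).inv.mul (measurable_det fun i j => ?_)
  simp only [Matrix.updateRow_apply]
  split_ifs
  · exact measurable_const
  · exact hS i j

lemma measurable_gaussianDensity {S : α → Matrix (Fin d) (Fin d) ℝ}
    (hS : ∀ a b, Measurable fun ω => S ω a b) {x m : α → EuclideanSpace ℝ (Fin d)}
    (hx : Measurable x) (hm : Measurable m) :
    Measurable fun ω => gaussianDensity (x ω) (m ω) (S ω) := by
  have hdet := measurable_det hS
  have hinv := measurable_inv_apply hS
  have hv : ∀ a, Measurable fun ω => (x ω - m ω).ofLp a :=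
    fun a => (EuclideanSpace.proj (𝕜 := ℝ) a).continuous.measurable.comp (hx.sub hm)
  have hmv : ∀ a, Measurable fun ω => ((S ω)⁻¹ *ᵥ (x ω - m ω).ofLp) a := fun a => by
    simp only [mulVec, dotProduct]
    exact Finset.measurable_sum _ fun b _ => (hinv a b).mul (hv b)
  have hq : Measurable fun ω => (x ω - m ω).ofLp ⬝ᵥ ((S ω)⁻¹ *ᵥ (x ω - m ω).ofLp) := by
    simp only [dotProduct]
    exact Finset.measurable_sum _ fun a _ => (hv a).mul (hmv a)
  exact (hdet.const_mul _).sqrt.inv.mul (hq.neg.div_const 2).exp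

lemma measurable_gaussianMixtureRatio {g : EuclideanSpace ℝ (Fin d) → ℝ}
    (hg : AEStronglyMeasurable g) (t₀ : EuclideanSpace ℝ (Fin d))
    {S : α → Matrix (Fin d) (Fin d) ℝ} (hS : ∀ a b, Measurable fun ω => S ω a b)
    {x : α → EuclideanSpace ℝ (Fin d)} (hx : Measurable x) :
    Measurable fun ω => gaussianMixtureRatio g t₀ (x ω) (S ω) := by
  -- Replacing `g` by a measurable version makes the integrand jointly measurable without changing
  -- any integral.
  have h : ∀ ω, ∫ t, gaussianDensity (x ω) t (S ω) * g t =
      ∫ t, gaussianDensity (x ω) t (S ω) * hg.mk g t := fun ω =>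
    integral_congr_ae (by
      filter_upwards [hg.ae_eq_mk] with t ht
      rw [ht])
  simp only [gaussianMixtureRatio, h]
  refine Measurable.div ?_ (measurable_gaussianDensity hS hx measurable_const)
  refine StronglyMeasurable.measurable (StronglyMeasurable.integral_prod_right
    (f := fun ω t => gaussianDensity (x ω) t (S ω) * hg.mk g t) ?_)
  refine Measurable.stronglyMeasurable ?_
  refine Measurable.mul ?_ (hg.stronglyMeasurable_mk.measurable.comp measurable_snd)
  exact measurable_gaussianDensity (S := fun z : α × EuclideanSpace ℝ (Fin d) => S z.1)
    (fun a b => (hS a b).comp measurable_fst) (hx.comp measurable_fst) measurable_snd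

end Measurability

/-! ### Uniform convergence of distribution functions. -/

section Polya

/-- Pólya's theorem: pointwise convergence of monotone functions with values in the unit interval
to a continuous distribution function is uniform. -/
lemma tendstoUniformly_of_monotone {ι : Type*} {l : Filter ι} {F : ι → ℝ → ℝ} {G : ℝ → ℝ}
    (hF : ∀ i, Monotone (F i)) (hF0 : ∀ i x, 0 ≤ F i x) (hF1 : ∀ i x, F i x ≤ 1)
    (hG : Monotone G) (hGc : Continuous G) (hG0 : Tendsto G atBot (𝓝 0))
    (hG1 : Tendsto G atTop (𝓝 1)) (h : ∀ x, Tendsto (fun i => F i x) l (𝓝 (G x))) :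
    TendstoUniformly F G l := by
  rw [Metric.tendstoUniformly_iff]
  intro ε hε
  have hGn : ∀ x, 0 ≤ G x := fun x => hG.le_of_tendsto hG0 x
  have hGo : ∀ x, G x ≤ 1 := fun x => hG.ge_of_tendsto hG1 x
  have near : ∀ x, ∀ᶠ i in l, |F i x - G x| < ε / 2 := fun x => by
    simpa [Real.dist_eq] using Metric.tendsto_nhds.1 (h x) (ε / 2) (half_pos hε)
  obtain ⟨a, ha⟩ := (hG0.eventually (gt_mem_nhds (half_pos hε))).exists
  obtain ⟨b, hb⟩ := (hG1.eventually (lt_mem_nhds (by linarith : 1 - ε / 2 < 1))).exists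
  have hmid : TendstoUniformlyOn F G l (Set.Icc a b) := by
    rw [← tendstoLocallyUniformlyOn_iff_tendstoUniformlyOn_of_compact isCompact_Icc,
      Metric.tendstoLocallyUniformlyOn_iff]
    intro η hη x _
    -- Monotonicity traps `F i y` and `G y` between their values at `x ± δ / 2`; the oscillation of
    -- `G` and the errors at the two endpoints total less than `η`.
    obtain ⟨δ, hδ, hδG⟩ := Metric.continuous_iff.1 hGc x (η / 4) (by positivity)
    have near' : ∀ y, ∀ᶠ i in l, |F i y - G y| < η / 4 := fun y => by
      simpa [Real.dist_eq] using Metric.tendsto_nhds.1 (h y) (η / 4) (by positivity)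
    have e1 := hδG (x - δ / 2) (by rw [Real.dist_eq]; simp [abs_of_pos (half_pos hδ)]; linarith)
    have e2 := hδG (x + δ / 2) (by rw [Real.dist_eq]; simp [abs_of_pos (half_pos hδ)]; linarith)
    rw [Real.dist_eq, abs_lt] at e1 e2
    refine ⟨Set.Icc (x - δ / 2) (x + δ / 2),
      mem_nhdsWithin_of_mem_nhds (Icc_mem_nhds (by linarith) (by linarith)), ?_⟩
    filter_upwards [near' (x - δ / 2), near' (x + δ / 2)] with i h1 h2 y hy
    rw [abs_lt] at h1 h2
    have := hF i hy.1
    have := hF i hy.2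
    have := hG hy.1
    have := hG hy.2
    rw [Real.dist_eq, abs_lt]
    constructor <;> linarith
  filter_upwards [Metric.tendstoUniformlyOn_iff.1 hmid ε hε, near a, near b] with i hi h1 h2 x
  rw [abs_lt] at h1 h2
  rcases lt_or_ge x a with hx | hx
  · have := hF i hx.le
    have := hG hx.le
    have := hF0 i x
    have := hGn x
    rw [Real.dist_eq, abs_lt]
    constructor <;> linarith
  rcases lt_or_ge b x with hx' | hx'
  · have := hF i hx'.le
    have := hG hx'.le
    have := hF1 i x
    have := hGo x
    rw [Real.dist_eq, abs_lt]
    constructor <;> linarith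
  exact hi x ⟨hx, hx'⟩

/-- The distribution function of an atomless random variable is continuous. -/
lemma continuous_measureReal_le {Ω : Type*} [MeasurableSpace Ω] {P : Measure Ω}
    [IsProbabilityMeasure P] {Z : Ω → ℝ} (hZ : Measurable Z) (h : ∀ x, P {ω | Z ω = x} = 0) :
    Continuous fun x => P.real {ω | Z ω ≤ x} := by
  rw [continuous_iff_continuousAt]
  intro x
  have hlim : ∀ y : ℕ → ℝ, Tendsto y atTop (𝓝 x) →
      Tendsto (fun n => P.real {ω | Z ω ≤ y n}) atTop (𝓝 (P.real {ω | Z ω ≤ x})) := by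
    intro y hy
    -- Moving the threshold into the variable leaves the fixed threshold 0, which is not an atom of
    -- `Z - x`.
    have hd : TendstoInDistribution (fun n ω => Z ω - y n) atTop (fun ω => Z ω - x)
        (fun _ => P) P :=
      tendstoInDistribution_of_ae_tendsto (fun n => by fun_prop) (by fun_prop)
        (Eventually.of_forall fun ω => tendsto_const_nhds.sub hy)
    have := tendsto_measureReal_le_of_tendstoInDistribution hd (x := 0)
      (by simpa [sub_eq_zero] using h x)
    simpa using this
  exact tendsto_of_seq_tendsto hlim

lemma tendsto_measureReal_le_atTop {Ω : Type*} [MeasurableSpace Ω] {P : Measure Ω}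
    [IsProbabilityMeasure P] {Z : Ω → ℝ} (hZ : Measurable Z) :
    Tendsto (fun x => P.real {ω | Z ω ≤ x}) atTop (𝓝 1) := by
  have : IsProbabilityMeasure (P.map Z) := Measure.isProbabilityMeasure_map hZ.aemeasurable
  refine (tendsto_cdf_atTop (P.map Z)).congr fun x => ?_
  rw [cdf_eq_real, map_measureReal_apply hZ measurableSet_Iic]
  rfl

lemma tendsto_measureReal_le_atBot {Ω : Type*} [MeasurableSpace Ω] {P : Measure Ω}
    [IsProbabilityMeasure P] {Z : Ω → ℝ} (hZ : Measurable Z) :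
    Tendsto (fun x => P.real {ω | Z ω ≤ x}) atBot (𝓝 0) := by
  have : IsProbabilityMeasure (P.map Z) := Measure.isProbabilityMeasure_map hZ.aemeasurable
  refine (tendsto_cdf_atBot (P.map Z)).congr fun x => ?_
  rw [cdf_eq_real, map_measureReal_apply hZ measurableSet_Iic]
  rfl

end Polya

/-! ### Limits of the mixture ratio for asymptotically normal estimators. -/

section AsymptoticNormality

variable {Ω : Type*} [MeasurableSpace Ω] {d : ℕ}

/-- `est` is an asymptotically normal sequence of estimators of `θ`, studentized by consistent
estimators `cov` of the positive definite matrix `S`. -/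
structure IsAsymptoticallyNormal (P : Measure Ω) [IsProbabilityMeasure P]
    (est : ℕ → Ω → EuclideanSpace ℝ (Fin d)) (cov : ℕ → Ω → Matrix (Fin d) (Fin d) ℝ)
    (θ : EuclideanSpace ℝ (Fin d)) (S : Matrix (Fin d) (Fin d) ℝ) : Prop where
  posDef : S.PosDef
  measurable_est : ∀ m, Measurable (est m)
  measurable_cov : ∀ m a b, Measurable fun ω => cov m ω a b
  posSemidef : ∀ m ω, (cov m ω).PosSemidef
  consistent : IsConsistentFor P cov S
  tendsto_studentized : TendstoInDistribution
    (fun m ω => studentized m (cov m ω) (est m ω) θ) atTop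
    (id : EuclideanSpace ℝ (Fin d) → EuclideanSpace ℝ (Fin d)) (fun _ => P)
    (stdGaussian (EuclideanSpace ℝ (Fin d)))

variable {P : Measure Ω} [IsProbabilityMeasure P] {est : ℕ → Ω → EuclideanSpace ℝ (Fin d)}
  {cov : ℕ → Ω → Matrix (Fin d) (Fin d) ℝ} {θ t₀ : EuclideanSpace ℝ (Fin d)}
  {S : Matrix (Fin d) (Fin d) ℝ} {g : EuclideanSpace ℝ (Fin d) → ℝ}

namespace IsAsymptoticallyNormal

lemma eventually_det_pos (hN : IsAsymptoticallyNormal P est cov θ S) :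
    ∀ᶠ z in inProbability P, 0 < (cov z.1 z.2).det := by
  have hc : Continuous fun A : Matrix (Fin d) (Fin d) ℝ => A.det := by fun_prop
  exact ((hc.tendsto S).comp (isConsistentFor_iff.1 hN.consistent)).eventually
    (lt_mem_nhds hN.posDef.det_pos)

lemma tendsto_inv_cov (hN : IsAsymptoticallyNormal P est cov θ S) :
    Tendsto (fun z : ℕ × Ω => (cov z.1 z.2)⁻¹) (inProbability P) (𝓝 S⁻¹) :=
  (Matrix.continuousAt_inv hN.posDef.det_pos.ne').tendsto.comp
    (isConsistentFor_iff.1 hN.consistent)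

/-- Consistency follows from studentized normality: by coercivity of the inverse covariance, the
squared error is at most a constant times `‖studentized‖ ^ 2 / m`, a tight sequence times a null
one. -/
lemma tendsto_est (hN : IsAsymptoticallyNormal P est cov θ S) :
    Tendsto (fun z : ℕ × Ω => est z.1 z.2) (inProbability P) (𝓝 θ) := by
  obtain ⟨c, hc, hco⟩ := hN.posDef.inv.eventually_coercive
  have hm : Tendsto (fun z : ℕ × Ω => (z.1 : ℝ)⁻¹) (inProbability P) (𝓝 0) :=
    (tendsto_inv_atTop_zero.comp tendsto_natCast_atTop_atTop).comp tendsto_fst_inProbability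
  have h1 := tendsto_mul_zero_of_tendstoInDistribution hN.tendsto_studentized
    (C := fun m _ => (m : ℝ)⁻¹) (fun m => aemeasurable_const) hm (ψ := fun v => ‖v‖ ^ 2)
    (by fun_prop)
  have h2 := (h1.const_mul c⁻¹).sqrt
  rw [mul_zero, Real.sqrt_zero] at h2
  rw [tendsto_iff_norm_sub_tendsto_zero]
  refine squeeze_zero' (Eventually.of_forall fun z => norm_nonneg _) ?_ h2
  filter_upwards [hN.tendsto_inv_cov.eventually hco, eventually_fst_ne_zero] with z hz hz0
  have hz' : (z.1 : ℝ) ≠ 0 := by exact_mod_cast hz0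
  refine Real.le_sqrt_of_sq_le ?_
  rw [norm_sq_studentized _ (hN.posSemidef _ _), mul_right_comm, mul_inv_cancel₀ hz', one_mul,
    le_inv_mul_iff₀ hc]
  exact hz _

lemma tendsto_prod (hN : IsAsymptoticallyNormal P est cov θ S) :
    Tendsto (fun z : ℕ × Ω => (z.1, (cov z.1 z.2)⁻¹, est z.1 z.2)) (inProbability P)
      (atTop ×ˢ 𝓝 S⁻¹ ×ˢ 𝓝 θ) :=
  tendsto_fst_inProbability.prodMk (hN.tendsto_inv_cov.prodMk hN.tendsto_est)

lemma eventually_ratio_eq (hN : IsAsymptoticallyNormal P est cov θ S) :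
    ∀ᶠ z in inProbability P,
      gaussianMixtureRatio g t₀ (est z.1 z.2) ((z.1 : ℝ)⁻¹ • cov z.1 z.2) =
        ∫ t, Real.exp (z.1 * (quadForm (cov z.1 z.2)⁻¹ (est z.1 z.2 - t₀) -
          quadForm (cov z.1 z.2)⁻¹ (est z.1 z.2 - t)) / 2) * g t := by
  filter_upwards [hN.eventually_det_pos, eventually_fst_ne_zero] with z h1 h2
  exact gaussianMixtureRatio_eq_integral g t₀ _ h2 h1

/-- Under the null hypothesis the studentized error can be split off from the mixture ratio. -/
lemma eventually_ratio_eq_exp_mul (hN : IsAsymptoticallyNormal P est cov θ S) :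
    ∀ᶠ z in inProbability P,
      gaussianMixtureRatio g θ (est z.1 z.2) ((z.1 : ℝ)⁻¹ • cov z.1 z.2) =
        Real.exp (‖studentized z.1 (cov z.1 z.2) (est z.1 z.2) θ‖ ^ 2 / 2) *
          ∫ t, Real.exp (-(z.1 * quadForm (cov z.1 z.2)⁻¹ (est z.1 z.2 - t) / 2)) * g t := by
  filter_upwards [hN.eventually_ratio_eq (g := g) (t₀ := θ)] with z h1
  rw [h1, ← integral_const_mul, norm_sq_studentized _ (hN.posSemidef _ _)]
  refine integral_congr_ae (Eventually.of_forall fun t => ?_)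
  simp only []
  rw [← mul_assoc, ← Real.exp_add]
  ring_nf

lemma measurable_ratio (hN : IsAsymptoticallyNormal P est cov θ S) (hg : Integrable g) (m : ℕ) :
    Measurable fun ω => gaussianMixtureRatio g t₀ (est m ω) ((m : ℝ)⁻¹ • cov m ω) :=
  measurable_gaussianMixtureRatio hg.1 t₀
    (fun a b => by
      simp only [Matrix.smul_apply, smul_eq_mul]
      exact (hN.measurable_cov m a b).const_mul _)
    (hN.measurable_est m)

lemma eventually_ratio_pos (hN : IsAsymptoticallyNormal P est cov θ S) (hg : Integrable g)
    (hg0 : ∀ t, 0 ≤ g t) (hg1 : 0 < ∫ t, g t) :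
    ∀ᶠ z in inProbability P,
      0 < gaussianMixtureRatio g t₀ (est z.1 z.2) ((z.1 : ℝ)⁻¹ • cov z.1 z.2) := by
  filter_upwards [hN.eventually_ratio_eq (g := g) (t₀ := t₀),
    hN.tendsto_prod.eventually (eventually_quadForm_nonneg hN.posDef.inv)] with z h1 h2
  rw [h1]
  refine integral_exp_mul_pos hg hg0 hg1
    (C := z.1 * quadForm (cov z.1 z.2)⁻¹ (est z.1 z.2 - t₀) / 2) ?_ fun t => ?_
  · have := continuous_quadForm_sub (cov z.1 z.2)⁻¹ (est z.1 z.2)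
    fun_prop
  · have := h2 (est z.1 z.2 - t)
    gcongr
    linarith

/-- Under the alternative the mixture ratio tends to infinity in probability. -/
lemma tendsto_ratio_atTop (hN : IsAsymptoticallyNormal P est cov θ S) (hg : Integrable g)
    (hg0 : ∀ t, 0 ≤ g t) (hne : θ ≠ t₀) (hsupp : ∀ U ∈ 𝓝 θ, 0 < ∫ t in U, g t) :
    Tendsto (fun z : ℕ × Ω =>
      gaussianMixtureRatio g t₀ (est z.1 z.2) ((z.1 : ℝ)⁻¹ • cov z.1 z.2))
      (inProbability P) atTop := by
  refine ((tendsto_integral_exp_quadForm_sub_atTop hg hg0 hN.posDef.inv hne hsupp).comp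
    hN.tendsto_prod).congr' ?_
  filter_upwards [hN.eventually_ratio_eq (g := g) (t₀ := t₀)] with z hz
  rw [hz]
  rfl

/-- If `ρ` is, up to events of vanishing probability, the product of a function of the studentized
error and a sequence that converges in probability, then it converges in distribution. -/
lemma tendstoInDistribution_exp_mul (hN : IsAsymptoticallyNormal P est cov θ S)
    {ρ : ℕ → Ω → ℝ} (hρ : ∀ m, Measurable (ρ m)) {K : ℕ × Ω → ℝ} {c : ℝ}
    (hK : Tendsto K (inProbability P) (𝓝 c))
    (h : ∀ᶠ z in inProbability P, ρ z.1 z.2 =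
      Real.exp (‖studentized z.1 (cov z.1 z.2) (est z.1 z.2) θ‖ ^ 2 / 2) * K z) :
    TendstoInDistribution ρ atTop
      (fun v : EuclideanSpace ℝ (Fin d) => Real.exp (‖v‖ ^ 2 / 2) * c) (fun _ => P)
      (stdGaussian (EuclideanSpace ℝ (Fin d))) := by
  -- Unlike `K`, this factor is measurable and reproduces `ρ` exactly everywhere; it agrees with `K`
  -- with probability tending to one, so Slutsky's theorem applies to it.
  let C : ℕ → Ω → ℝ := fun m ω =>
    ρ m ω * Real.exp (-(‖studentized m (cov m ω) (est m ω) θ‖ ^ 2 / 2))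
  have hCm : ∀ m, AEMeasurable (C m) P := fun m => by
    have := hN.tendsto_studentized.forall_aemeasurable m
    have := hρ m
    fun_prop
  have hC : Tendsto (fun z : ℕ × Ω => C z.1 z.2) (inProbability P) (𝓝 c) := by
    refine hK.congr' ?_
    filter_upwards [h] with z hz
    simp only [C]
    rw [hz, mul_right_comm, ← Real.exp_add, add_neg_cancel, Real.exp_zero, one_mul]
  have := hN.tendsto_studentized.continuous_comp_prodMk_of_tendstoInMeasure_const
    (g := fun z : EuclideanSpace ℝ (Fin d) × ℝ => Real.exp (‖z.1‖ ^ 2 / 2) * z.2) (by fun_prop)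
    (tendstoInMeasure_const_iff.2 hC) hCm
  have hρC : ρ = fun m ω =>
      Real.exp (‖studentized m (cov m ω) (est m ω) θ‖ ^ 2 / 2) * C m ω := by
    funext m ω
    simp only [C]
    rw [mul_left_comm, ← Real.exp_add, add_neg_cancel, Real.exp_zero, mul_one]
  rw [hρC]
  exact this

/-- The limit of the distribution functions of the mixture ratios. -/
lemma tendsto_measureReal_ratio_le [NeZero d] (hN : IsAsymptoticallyNormal P est cov θ S)
    (hg : Integrable g) (hg0 : ∀ t, 0 ≤ g t) (hg1 : 0 < ∫ t, g t)
    (hsupp : θ ≠ t₀ → ∀ U ∈ 𝓝 θ, 0 < ∫ t in U, g t) (y : ℝ) :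
    Tendsto (fun m : ℕ => P.real {ω |
      gaussianMixtureRatio g t₀ (est m ω) ((m : ℝ)⁻¹ • cov m ω) ≤ y}) atTop
      (𝓝 (open Classical in if θ = t₀ ∧ 0 < y then 1 else 0)) := by
  split_ifs with hcase
  · obtain ⟨rfl, hy⟩ := hcase
    -- The second factor vanishes in probability, so the limit law is the point mass at zero and a
    -- positive `y` is not an atom.
    have hK := (tendsto_integral_exp_neg_quadForm_zero hg hN.posDef.inv).comp hN.tendsto_prod
    have h := hN.tendstoInDistribution_exp_mul (fun m => hN.measurable_ratio (t₀ := θ) hg m) hK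
      hN.eventually_ratio_eq_exp_mul
    have := tendsto_measureReal_le_of_tendstoInDistribution h (x := y) (by simp [hy.ne])
    simpa [hy.le] using this
  · refine tendsto_measureReal_zero (p := fun z : ℕ × Ω =>
      gaussianMixtureRatio g t₀ (est z.1 z.2) ((z.1 : ℝ)⁻¹ • cov z.1 z.2) ≤ y) ?_
    by_cases hne : θ = t₀
    -- Convergence to zero alone would leave `y = 0` undecided; positivity of the ratio settles it.
    · have hy : y ≤ 0 := not_lt.1 fun hy => hcase ⟨hne, hy⟩
      filter_upwards [hN.eventually_ratio_pos (t₀ := t₀) hg hg0 hg1] with z hz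
      exact not_le.2 (hy.trans_lt hz)
    · filter_upwards [(hN.tendsto_ratio_atTop hg hg0 hne (hsupp hne)).eventually_gt_atTop y]
        with z hz
      exact not_le.2 hz

/-- Under the null hypothesis, the limit law of the normalized mixture ratios when the mixing
density is continuous at the null value. -/
lemma tendstoInDistribution_sqrt_pow_mul_ratio (hN : IsAsymptoticallyNormal P est cov θ S)
    (hg : Integrable g) (hcont : ContinuousAt g θ) :
    TendstoInDistribution (fun (m : ℕ) ω => √(m : ℝ) ^ d *
        gaussianMixtureRatio g θ (est m ω) ((m : ℝ)⁻¹ • cov m ω)) atTop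
      (fun v : EuclideanSpace ℝ (Fin d) =>
        Real.exp (‖v‖ ^ 2 / 2) * ∫ u, Real.exp (-(quadForm S⁻¹ u / 2)) * g θ)
      (fun _ => P) (stdGaussian (EuclideanSpace ℝ (Fin d))) := by
  have hK := (tendsto_sqrt_pow_mul_integral_exp_neg_quadForm hg hN.posDef.inv hcont).comp
    hN.tendsto_prod
  refine hN.tendstoInDistribution_exp_mul
    (fun m => (hN.measurable_ratio (t₀ := θ) hg m).const_mul _) hK ?_
  filter_upwards [hN.eventually_ratio_eq_exp_mul (g := g)] with z hz
  rw [hz, mul_left_comm]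
  rfl

end IsAsymptoticallyNormal

lemma Matrix.PosDef.integral_exp_neg_quadForm_mul_pos {A : Matrix (Fin d) (Fin d) ℝ}
    (hA : A.PosDef) {r : ℝ} (hr : 0 < r) :
    0 < ∫ u : EuclideanSpace ℝ (Fin d), Real.exp (-(quadForm A u / 2)) * r := by
  obtain ⟨c, hc, hco⟩ := hA.eventually_coercive
  rw [integral_mul_const]
  refine mul_pos (integral_exp_pos ?_) hr
  refine (integrable_exp_neg_mul_sq_norm (d := d) (half_pos hc)).mono' ?_
    (Eventually.of_forall fun v => ?_)
  · refine Continuous.aestronglyMeasurable ?_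
    have : Continuous (quadForm A) := continuous_quadForm.comp (Continuous.prodMk_right A)
    fun_prop
  · rw [Real.norm_eq_abs, Real.abs_exp]
    have := hco.self_of_nhds v
    gcongr
    linarith

/-- A level set of a strictly increasing function of the norm lies in a sphere, which is null when
`d ≥ 1`. -/
lemma stdGaussian_exp_norm_sq_mul_eq [NeZero d] {c : ℝ} (hc : 0 < c) (y : ℝ) :
    stdGaussian (EuclideanSpace ℝ (Fin d)) {v | Real.exp (‖v‖ ^ 2 / 2) * c = y} = 0 := by
  have : Nonempty (Fin d) := ⟨⟨0, Nat.pos_of_ne_zero (NeZero.ne d)⟩⟩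
  rcases Set.eq_empty_or_nonempty
    {v : EuclideanSpace ℝ (Fin d) | Real.exp (‖v‖ ^ 2 / 2) * c = y} with h | ⟨v₀, hv₀⟩
  · rw [h, measure_empty]
  · refine measure_mono_null ?_ (stdGaussian_sphere ‖v₀‖)
    intro v hv
    have h1 : Real.exp (‖v‖ ^ 2 / 2) * c = Real.exp (‖v₀‖ ^ 2 / 2) * c := Eq.trans hv hv₀.symm
    have h2 := Real.exp_injective (mul_right_cancel₀ hc.ne' h1)
    have h3 : ‖v‖ ^ 2 = ‖v₀‖ ^ 2 := by linarith
    rw [mem_sphere_zero_iff_norm]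
    exact (sq_eq_sq₀ (norm_nonneg _) (norm_nonneg _)).1 h3

/-- Under the null hypothesis the distribution functions of the normalized mixture ratios converge
uniformly. -/
lemma IsAsymptoticallyNormal.tendstoUniformly_ratio [NeZero d]
    (hN : IsAsymptoticallyNormal P est cov θ S) (hg : Integrable g) (hcont : ContinuousAt g θ)
    (hpos : 0 < g θ) :
    TendstoUniformly (fun (m : ℕ) y => P.real {ω | √(m : ℝ) ^ d *
        gaussianMixtureRatio g θ (est m ω) ((m : ℝ)⁻¹ • cov m ω) ≤ y})
      (fun y => (stdGaussian (EuclideanSpace ℝ (Fin d))).real {v |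
        Real.exp (‖v‖ ^ 2 / 2) * (∫ u, Real.exp (-(quadForm S⁻¹ u / 2)) * g θ) ≤ y})
      atTop := by
  have hc := hN.posDef.inv.integral_exp_neg_quadForm_mul_pos hpos
  have hm : Measurable fun v : EuclideanSpace ℝ (Fin d) =>
      Real.exp (‖v‖ ^ 2 / 2) * ∫ u, Real.exp (-(quadForm S⁻¹ u / 2)) * g θ := by fun_prop
  exact tendstoUniformly_of_monotone
    (fun m a b hab => measureReal_mono fun ω hω => le_trans hω hab)
    (fun m y => measureReal_nonneg) (fun m y => measureReal_le_one)
    (fun a b hab => measureReal_mono fun ω hω => le_trans hω hab)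
    (continuous_measureReal_le hm (stdGaussian_exp_norm_sq_mul_eq hc))
    (tendsto_measureReal_le_atBot hm) (tendsto_measureReal_le_atTop hm)
    (fun y => tendsto_measureReal_le_of_tendstoInDistribution
      (hN.tendstoInDistribution_sqrt_pow_mul_ratio hg hcont)
      (stdGaussian_exp_norm_sq_mul_eq hc y))

end AsymptoticNormality

/-! ### Reduction of the batch mSPRT to the Gaussian location model. -/

section GaussianBatches

variable {d : ℕ}

lemma quadForm_eq_inner (A : Matrix (Fin d) (Fin d) ℝ) (v : EuclideanSpace ℝ (Fin d)) :
    quadForm A v = inner ℝ v (Matrix.toEuclideanCLM (𝕜 := ℝ) A v) :=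
  (inner_toEuclideanCLM A v v).symm

/-- The terms quadratic in `s` cancel. What remains is affine in `s`, so summing over batches leaves
only the total. -/
lemma quadForm_sub_smul_sub (A : Matrix (Fin d) (Fin d) ℝ) (r : ℝ)
    (s a b : EuclideanSpace ℝ (Fin d)) :
    quadForm A (s - r • a) - quadForm A (s - r • b) =
      r * (inner ℝ s (Matrix.toEuclideanCLM (𝕜 := ℝ) A (b - a)) +
        inner ℝ (b - a) (Matrix.toEuclideanCLM (𝕜 := ℝ) A s)) +
      r ^ 2 * (quadForm A a - quadForm A b) := by
  simp only [quadForm_eq_inner, map_sub, map_smul, inner_sub_left, inner_sub_right,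
    real_inner_smul_left, real_inner_smul_right]
  ring

/-- The log-likelihood ratio of Gaussian batch totals depends on their mean only. -/
lemma sum_quadForm_sub (A : Matrix (Fin d) (Fin d) ℝ) {n k : ℕ} (hnk : n * k ≠ 0)
    (s : Fin n → EuclideanSpace ℝ (Fin d)) (a b : EuclideanSpace ℝ (Fin d)) :
    ∑ j, (quadForm ((k : ℝ)⁻¹ • A) (s j - (k : ℝ) • a) -
        quadForm ((k : ℝ)⁻¹ • A) (s j - (k : ℝ) • b)) =
      ((n * k : ℕ) : ℝ) * (quadForm A (((n * k : ℕ) : ℝ)⁻¹ • ∑ j, s j - a) -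
        quadForm A (((n * k : ℕ) : ℝ)⁻¹ • ∑ j, s j - b)) := by
  have hk : (k : ℝ) ≠ 0 := by exact_mod_cast (mul_ne_zero_iff.1 hnk).2
  have hn : (n : ℝ) ≠ 0 := by exact_mod_cast (mul_ne_zero_iff.1 hnk).1
  have h1 := quadForm_sub_smul_sub A 1 (((n * k : ℕ) : ℝ)⁻¹ • ∑ j, s j) a b
  rw [one_smul, one_smul] at h1
  rw [h1]
  simp only [quadForm_smul_left, ← mul_sub, quadForm_sub_smul_sub]
  simp only [map_smul, real_inner_smul_left, real_inner_smul_right, map_sum, sum_inner, inner_sum,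
    mul_add, Finset.sum_add_distrib, ← Finset.mul_sum, Finset.sum_const, Finset.card_univ,
    Fintype.card_fin, nsmul_eq_mul]
  push_cast
  field_simp

/-- The mixture likelihood ratio of Gaussian batch totals is the Gaussian mixture ratio at their
mean. -/
lemma mixtureLR_gaussian (g : EuclideanSpace ℝ (Fin d) → ℝ) (t₀ : EuclideanSpace ℝ (Fin d))
    {S : Matrix (Fin d) (Fin d) ℝ} (hS : 0 < S.det) {n k : ℕ} (hnk : n * k ≠ 0)
    (s : Fin n → EuclideanSpace ℝ (Fin d)) :
    mixtureLR (fun t y => gaussianDensity y ((k : ℝ) • t) ((k : ℝ) • S)) g t₀ s =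
      gaussianMixtureRatio g t₀ (((n * k : ℕ) : ℝ)⁻¹ • ∑ j, s j)
        (((n * k : ℕ) : ℝ)⁻¹ • S) := by
  have hk : (0 : ℝ) < k := by exact_mod_cast Nat.pos_of_ne_zero (mul_ne_zero_iff.1 hnk).2
  have hdet : 0 < ((k : ℝ) • S).det := by
    rw [Matrix.det_smul]
    positivity
  have hprod : 0 < ∏ j, gaussianDensity (s j) ((k : ℝ) • t₀) ((k : ℝ) • S) :=
    Finset.prod_pos fun j _ => gaussianDensity_pos _ _ hdet
  rw [gaussianMixtureRatio_eq_integral g t₀ _ hnk hS, mixtureLR, div_eq_iff hprod.ne', mul_comm,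
    ← integral_const_mul]
  refine integral_congr_ae (Eventually.of_forall fun t => ?_)
  simp only []
  rw [← sum_quadForm_sub _ hnk, Finset.sum_div, Real.exp_sum, ← mul_assoc,
    ← Finset.prod_mul_distrib]
  congr 1
  refine Finset.prod_congr rfl fun j _ => ?_
  rw [gaussianDensity_eq_mul_exp _ ((k : ℝ) • t₀), inv_smul_of_ne_zero hk.ne' hS.ne']

/-- The law of the sum of independent Gaussian batch totals. -/
lemma map_sum_pi_multivariateGaussian (t : EuclideanSpace ℝ (Fin d))
    {S : Matrix (Fin d) (Fin d) ℝ} (hS : S.PosSemidef) (n k : ℕ) :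
    (Measure.pi fun _ : Fin n => multivariateGaussian ((k : ℝ) • t) ((k : ℝ) • S)).map
        (fun s => ∑ j, s j) =
      (stdGaussian (EuclideanSpace ℝ (Fin d))).map fun v => ((n * k : ℕ) : ℝ) • t +
        √((n * k : ℕ) : ℝ) • Matrix.toEuclideanCLM (𝕜 := ℝ) (CFC.sqrt S) v := by
  have hstep : (stdGaussian (EuclideanSpace ℝ (Fin d))).map (fun v => ((n * k : ℕ) : ℝ) • t +
      √((n * k : ℕ) : ℝ) • Matrix.toEuclideanCLM (𝕜 := ℝ) (CFC.sqrt S) v) =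
      multivariateGaussian (((n * k : ℕ) : ℝ) • t) (((n * k : ℕ) : ℝ) • S) := by
    have h1 : (fun v : EuclideanSpace ℝ (Fin d) => ((n * k : ℕ) : ℝ) • t +
        √((n * k : ℕ) : ℝ) • Matrix.toEuclideanCLM (𝕜 := ℝ) (CFC.sqrt S) v) =
        (fun y => ((n * k : ℕ) : ℝ) • t + y) ∘ (fun y => √((n * k : ℕ) : ℝ) • y) ∘
          fun v => 0 + Matrix.toEuclideanCLM (𝕜 := ℝ) (CFC.sqrt S) v := by
      ext v
      simp
    rw [h1, ← Measure.map_map (by fun_prop) (by fun_prop),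
      ← Measure.map_map (by fun_prop) (by fun_prop), ← multivariateGaussian]
    have : IsProbabilityMeasure (((multivariateGaussian 0 S).map
        (fun y => √((n * k : ℕ) : ℝ) • y)).map (fun y => ((n * k : ℕ) : ℝ) • t + y)) := by
      have := Measure.isProbabilityMeasure_map (μ := multivariateGaussian 0 S)
        (f := fun y => √((n * k : ℕ) : ℝ) • y) (by fun_prop)
      exact Measure.isProbabilityMeasure_map (by fun_prop)
    -- Scaling by `√(n * k)` multiplies the covariance by `n * k`, as read off from the
    -- characteristic function.
    refine Measure.ext_of_charFun ?_
    ext u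
    rw [charFun_map_const_add, charFun_map_smul, charFun_multivariateGaussian hS,
      charFun_multivariateGaussian (hS.smul (Nat.cast_nonneg _)), ← Complex.exp_add,
      real_inner_comm u]
    congr 1
    simp only [inner_zero_right, WithLp.ofLp_smul, mulVec_smul, smul_mulVec, smul_dotProduct,
      dotProduct_smul, smul_eq_mul, ← mul_assoc, Real.mul_self_sqrt (Nat.cast_nonneg (n * k))]
    push_cast
    ring
  rw [hstep]
  have := Measure.isProbabilityMeasure_map (μ := Measure.pi fun _ : Fin n =>
    multivariateGaussian ((k : ℝ) • t) ((k : ℝ) • S)) (f := fun s => ∑ j, s j)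
    (by fun_prop)
  refine Measure.ext_of_charFun ?_
  rw [charFun_map_sum_pi_eq_prod]
  ext u
  rw [Finset.prod_apply, Finset.prod_const, charFun_multivariateGaussian
    (hS.smul (Nat.cast_nonneg _)), charFun_multivariateGaussian (hS.smul (Nat.cast_nonneg _)),
    ← Complex.exp_nat_mul]
  congr 1
  simp only [smul_mulVec, dotProduct_smul, smul_eq_mul, real_inner_smul_right, Finset.card_univ,
    Fintype.card_fin]
  push_cast
  ring

/-- The exact Gaussian location estimator with mean `t` and covariance matrix `S / m`. -/
def gaussianEstimator (t : EuclideanSpace ℝ (Fin d)) (S : Matrix (Fin d) (Fin d) ℝ) (m : ℕ)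
    (v : EuclideanSpace ℝ (Fin d)) : EuclideanSpace ℝ (Fin d) :=
  t + (√(m : ℝ))⁻¹ • Matrix.toEuclideanCLM (𝕜 := ℝ) (CFC.sqrt S) v

lemma measurable_gaussianEstimator (t : EuclideanSpace ℝ (Fin d)) (S : Matrix (Fin d) (Fin d) ℝ)
    (m : ℕ) : Measurable (gaussianEstimator t S m) := by
  unfold gaussianEstimator
  fun_prop

/-- The distribution function of the batch mSPRT, computed in the Gaussian location model. -/
lemma batchMSPRTCDF_eq (t : EuclideanSpace ℝ (Fin d)) {S : Matrix (Fin d) (Fin d) ℝ}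
    (hS : S.PosDef) {g : EuclideanSpace ℝ (Fin d) → ℝ} (hg : Integrable g)
    (t₀ : EuclideanSpace ℝ (Fin d)) {n k : ℕ} (hnk : n * k ≠ 0) (x : ℝ) :
    batchMSPRTCDF t S g t₀ n k x = (stdGaussian (EuclideanSpace ℝ (Fin d))).real {v |
      gaussianMixtureRatio g t₀ (gaussianEstimator t S (n * k) v)
        (((n * k : ℕ) : ℝ)⁻¹ • S) ≤ x} := by
  have hm : (0 : ℝ) < ((n * k : ℕ) : ℝ) := by exact_mod_cast Nat.pos_of_ne_zero hnk
  let f : EuclideanSpace ℝ (Fin d) → ℝ := fun u =>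
    gaussianMixtureRatio g t₀ (((n * k : ℕ) : ℝ)⁻¹ • u) (((n * k : ℕ) : ℝ)⁻¹ • S)
  have hf : Measurable f := measurable_gaussianMixtureRatio hg.1 t₀
    (S := fun _ => ((n * k : ℕ) : ℝ)⁻¹ • S) (fun a b => measurable_const)
    (measurable_const_smul _)
  have hV : MeasurableSet (f ⁻¹' Set.Iic x) := hf measurableSet_Iic
  have h1 : ∀ s : Fin n → EuclideanSpace ℝ (Fin d),
      mixtureLR (fun t y => gaussianDensity y ((k : ℝ) • t) ((k : ℝ) • S)) g t₀ s =
        f (∑ j, s j) := mixtureLR_gaussian g t₀ hS.det_pos hnk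
  have h2 : ∀ v, gaussianMixtureRatio g t₀ (gaussianEstimator t S (n * k) v)
      (((n * k : ℕ) : ℝ)⁻¹ • S) = f (((n * k : ℕ) : ℝ) • t +
        √((n * k : ℕ) : ℝ) • Matrix.toEuclideanCLM (𝕜 := ℝ) (CFC.sqrt S) v) := fun v => by
    have h3 : ((n * k : ℕ) : ℝ)⁻¹ * √((n * k : ℕ) : ℝ) = (√((n * k : ℕ) : ℝ))⁻¹ := by
      rw [inv_mul_eq_div, Real.sqrt_div_self']
      exact one_div _
    simp only [f]
    rw [gaussianEstimator, smul_add, smul_smul, smul_smul, inv_mul_cancel₀ hm.ne', one_smul, h3]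
  simp only [batchMSPRTCDF, h1, h2]
  have hlaw := congrArg (fun μ : Measure (EuclideanSpace ℝ (Fin d)) => μ.real (f ⁻¹' Set.Iic x))
    (map_sum_pi_multivariateGaussian t hS.posSemidef n k)
  simp only [] at hlaw
  rw [map_measureReal_apply (Finset.measurable_sum _ fun j _ => measurable_pi_apply j) hV,
    map_measureReal_apply (by fun_prop) hV] at hlaw
  exact hlaw

lemma studentized_gaussianEstimator (t : EuclideanSpace ℝ (Fin d))
    {S : Matrix (Fin d) (Fin d) ℝ} (hS : S.PosDef) {m : ℕ} (hm : m ≠ 0)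
    (v : EuclideanSpace ℝ (Fin d)) : studentized m S (gaussianEstimator t S m v) t = v := by
  have hm' : (0 : ℝ) < m := by exact_mod_cast Nat.pos_of_ne_zero hm
  -- The square of this determinant is `S.det`, which is positive.
  have hdet : IsUnit (CFC.sqrt S).det := by
    have h := congrArg Matrix.det (CFC.sqrt_mul_sqrt_self S hS.posSemidef.nonneg)
    rw [Matrix.det_mul] at h
    refine isUnit_iff_ne_zero.2 fun h0 => hS.det_pos.ne' ?_
    rw [← h, h0, zero_mul]
  rw [studentized, gaussianEstimator, add_sub_cancel_left, map_smul, smul_smul,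
    mul_inv_cancel₀ (Real.sqrt_pos.2 hm').ne', one_smul, ← mul_apply_eq_comp,
    ← map_mul, Matrix.nonsing_inv_mul _ hdet, map_one, one_apply_eq_self]

/-- The Gaussian location model is asymptotically normal. -/
lemma isAsymptoticallyNormal_gaussianEstimator (t : EuclideanSpace ℝ (Fin d))
    {S : Matrix (Fin d) (Fin d) ℝ} (hS : S.PosDef) :
    IsAsymptoticallyNormal (stdGaussian (EuclideanSpace ℝ (Fin d))) (gaussianEstimator t S)
      (fun _ _ => S) t S where
  posDef := hS
  measurable_est := measurable_gaussianEstimator t S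
  measurable_cov _ _ _ := measurable_const
  posSemidef _ _ := hS.posSemidef
  consistent := isConsistentFor_iff.2 tendsto_const_nhds
  tendsto_studentized := by
    refine tendstoInDistribution_of_ae_tendsto (fun m => ?_) aemeasurable_id
      (Eventually.of_forall fun v => ?_)
    · have := measurable_gaussianEstimator t S m
      unfold studentized
      fun_prop
    · refine tendsto_const_nhds.congr' ?_
      filter_upwards [eventually_ne_atTop 0] with m hm
      exact (studentized_gaussianEstimator t hS hm v).symm

end GaussianBatches

/-! ### The degenerate case `d = 0`. -/

section DimensionZero

lemma gaussianDensity_dim_zero (x m : EuclideanSpace ℝ (Fin 0)) (S : Matrix (Fin 0) (Fin 0) ℝ) :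
    gaussianDensity x m S = 1 := by
  simp [gaussianDensity]

lemma mixtureLR_one {𝒴 : Type*} {d : ℕ} {g : EuclideanSpace ℝ (Fin d) → ℝ} (hg1 : ∫ t, g t = 1)
    (t₀ : EuclideanSpace ℝ (Fin d)) {n : ℕ} (y : Fin n → 𝒴) :
    mixtureLR (fun _ _ => 1) g t₀ y = 1 := by
  simp [mixtureLR, hg1]

lemma gaussianMixtureRatio_dim_zero {g : EuclideanSpace ℝ (Fin 0) → ℝ} (hg1 : ∫ t, g t = 1)
    (t₀ x : EuclideanSpace ℝ (Fin 0)) (S : Matrix (Fin 0) (Fin 0) ℝ) :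
    gaussianMixtureRatio g t₀ x S = 1 := by
  simp [gaussianMixtureRatio, gaussianDensity_dim_zero, hg1]

lemma measureReal_setOf_const {α β : Type*} [MeasurableSpace α] [MeasurableSpace β]
    (μ : Measure α) (ν : Measure β) [IsProbabilityMeasure μ] [IsProbabilityMeasure ν] (p : Prop) :
    μ.real {_a | p} = ν.real {_b | p} := by
  by_cases hp : p <;> simp [hp]

/-- In dimension zero both test statistics are constant. -/
lemma approxCDF_sub_batchMSPRTCDF_dim_zero {Ω 𝒳 : Type*} [MeasurableSpace Ω] (P : Measure Ω)
    [IsProbabilityMeasure P] (X : ℕ → Ω → 𝒳)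
    (est : (m : ℕ) → (Fin m → 𝒳) → EuclideanSpace ℝ (Fin 0))
    (Sest : (m : ℕ) → (Fin m → 𝒳) → Matrix (Fin 0) (Fin 0) ℝ)
    (t : EuclideanSpace ℝ (Fin 0)) (S : Matrix (Fin 0) (Fin 0) ℝ)
    {g : EuclideanSpace ℝ (Fin 0) → ℝ} (hg1 : ∫ t, g t = 1) (t₀ : EuclideanSpace ℝ (Fin 0))
    (n k : ℕ) (x : ℝ) :
    approxCDF P X est Sest g t₀ n k x - batchMSPRTCDF t S g t₀ n k x = 0 := by
  simp only [approxCDF, batchMSPRTCDF, gaussianMixtureRatio_dim_zero hg1,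
    gaussianDensity_dim_zero, mixtureLR_one hg1]
  exact sub_eq_zero.2 (measureReal_setOf_const _ _ _)

end DimensionZero

/-! ### Comparison of two asymptotically normal models. -/

section Equivalence

variable {Ω Ω' : Type*} [MeasurableSpace Ω] [MeasurableSpace Ω'] {d : ℕ} {P : Measure Ω}
  [IsProbabilityMeasure P] {P' : Measure Ω'} [IsProbabilityMeasure P']
  {est : ℕ → Ω → EuclideanSpace ℝ (Fin d)} {cov : ℕ → Ω → Matrix (Fin d) (Fin d) ℝ}
  {est' : ℕ → Ω' → EuclideanSpace ℝ (Fin d)} {cov' : ℕ → Ω' → Matrix (Fin d) (Fin d) ℝ}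
  {θ : EuclideanSpace ℝ (Fin d)} {S : Matrix (Fin d) (Fin d) ℝ}
  {g : EuclideanSpace ℝ (Fin d) → ℝ}

/-- Two asymptotically normal models with the same parameter and the same covariance matrix have
uniformly close distribution functions of the mixture ratios under the null hypothesis. -/
lemma IsAsymptoticallyNormal.tendstoUniformly_sub [NeZero d]
    (hN : IsAsymptoticallyNormal P est cov θ S) (hN' : IsAsymptoticallyNormal P' est' cov' θ S)
    (hg : Integrable g) (hcont : ContinuousAt g θ) (hpos : 0 < g θ) :
    TendstoUniformly (fun (m : ℕ) y =>
      P.real {ω | gaussianMixtureRatio g θ (est m ω) ((m : ℝ)⁻¹ • cov m ω) ≤ y} -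
        P'.real {ω | gaussianMixtureRatio g θ (est' m ω) ((m : ℝ)⁻¹ • cov' m ω) ≤ y})
      (fun _ => 0) atTop := by
  have h1 := hN.tendstoUniformly_ratio hg hcont hpos
  have h2 := hN'.tendstoUniformly_ratio hg hcont hpos
  rw [Metric.tendstoUniformly_iff] at h1 h2 ⊢
  intro ε hε
  filter_upwards [h1 (ε / 2) (half_pos hε), h2 (ε / 2) (half_pos hε), eventually_ne_atTop 0]
    with m h1 h2 hm y
  have hm' : 0 < √(m : ℝ) ^ d := by
    have : (0 : ℝ) < m := by exact_mod_cast Nat.pos_of_ne_zero hm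
    positivity
  -- Uniformity permits a threshold that moves with `m`; at this one the factor `√m ^ d` cancels,
  -- and both models share the same limit value.
  have h3 := h1 (√(m : ℝ) ^ d * y)
  have h4 := h2 (√(m : ℝ) ^ d * y)
  simp only [mul_le_mul_iff_right₀ hm'] at h3 h4
  have h5 := dist_triangle_left (P.real {ω | gaussianMixtureRatio g θ (est m ω)
    ((m : ℝ)⁻¹ • cov m ω) ≤ y}) (P'.real {ω | gaussianMixtureRatio g θ (est' m ω)
    ((m : ℝ)⁻¹ • cov' m ω) ≤ y}) ((stdGaussian (EuclideanSpace ℝ (Fin d))).real {v |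
        Real.exp (‖v‖ ^ 2 / 2) * (∫ u, Real.exp (-(quadForm S⁻¹ u / 2)) * g θ) ≤
          √(m : ℝ) ^ d * y})
  rw [dist_zero_left, ← dist_eq_norm]
  linarith

lemma tendsto_mul_manyObservations :
    Tendsto (fun nk : ℕ × ℕ => nk.1 * nk.2) manyObservations atTop :=
  tendsto_comap

end Equivalence

end

theorem theorem5
    {Ω 𝒳 I : Type*} [MeasurableSpace Ω] [MeasurableSpace 𝒳] {p q d : ℕ}
    -- the possible true laws, indexed by `i : I`, and the i.i.d. observations
    (P : I → Measure Ω) [∀ i, IsProbabilityMeasure (P i)]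
    (X : ℕ → Ω → 𝒳) (hX : ∀ j, Measurable (X j))
    (hindep : ∀ i, iIndepFun X (P i))
    (hident : ∀ i j, IdentDistrib (X j) (X 0) (P i) (P i))
    -- the GMM estimators of the full parameter vector `full i`
    (full : I → EuclideanSpace ℝ (Fin p))
    (γ : 𝒳 → EuclideanSpace ℝ (Fin p) → EuclideanSpace ℝ (Fin q))
    (T : Set (EuclideanSpace ℝ (Fin p)))
    (W : (m : ℕ) → (Fin m → 𝒳) → Matrix (Fin q) (Fin q) ℝ)
    (fullEst : (m : ℕ) → (Fin m → 𝒳) → EuclideanSpace ℝ (Fin p))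
    (hfullEst : ∀ m, Measurable (fullEst m))
    (hgmm : ∀ i, IsGMMEstimator (P i) X γ T W fullEst (full i))
    -- the subset of interest and its limiting distribution
    (e : Fin d ↪ Fin p)
    (S : I → Matrix (Fin d) (Fin d) ℝ) (hS : ∀ i, (S i).PosDef)
    (Sest : (m : ℕ) → (Fin m → 𝒳) → Matrix (Fin d) (Fin d) ℝ)
    (hSest_meas : ∀ m a b, Measurable fun x => Sest m x a b)
    (hSest_psd : ∀ m x, (Sest m x).PosSemidef)
    (hSest : ∀ i, IsConsistentFor (P i) (fun m ω => Sest m (sample X m ω)) (S i))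
    (hlim : ∀ i, TendstoInDistribution
      (fun m ω => studentized m (Sest m (sample X m ω))
        (subvector e (fullEst m (sample X m ω))) (subvector e (full i)))
      atTop (id : EuclideanSpace ℝ (Fin d) → EuclideanSpace ℝ (Fin d)) (fun _ => P i)
      (stdGaussian (EuclideanSpace ℝ (Fin d))))
    -- the null value and the mixing density, whose support contains every alternative value
    (t₀ : EuclideanSpace ℝ (Fin d))
    (g : EuclideanSpace ℝ (Fin d) → ℝ) (hg_nonneg : ∀ t, 0 ≤ g t)
    (hg_int : Integrable g) (hg_one : ∫ t, g t = 1)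
    (hg_supp : ∀ i, subvector e (full i) ≠ t₀ →
      ∀ U ∈ 𝓝 (subvector e (full i)), 0 < ∫ t in U, g t) :
    IsAsymptoticallyEquivalent
      (fun i n k => approxCDF (P i) X (fun m x => subvector e (fullEst m x)) Sest g t₀ n k)
      (fun i n k => batchMSPRTCDF (subvector e (full i)) (S i) g t₀ n k) ∧
    -- under the null hypothesis the convergence is uniform in the threshold
    (ContinuousAt g t₀ → 0 < g t₀ → ∀ i, subvector e (full i) = t₀ →
      TendstoUniformly
        (fun (nk : ℕ × ℕ) (x : ℝ) =>
          approxCDF (P i) X (fun m x => subvector e (fullEst m x)) Sest g t₀ nk.1 nk.2 x -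
            batchMSPRTCDF (subvector e (full i)) (S i) g t₀ nk.1 nk.2 x)
        (fun _ => 0) manyObservations) := by 
  -- For `d = 0` points are not null and the ratio does not vanish under the null, but both
  -- statistics equal 1 identically.
  rcases Nat.eq_zero_or_pos d with rfl | hd
  · constructor
    · intro i x
      simp only [approxCDF_sub_batchMSPRTCDF_dim_zero _ _ _ _ _ _ hg_one]
      exact tendsto_const_nhds
    · intro _ _ i _
      simp only [approxCDF_sub_batchMSPRTCDF_dim_zero _ _ _ _ _ _ hg_one]
      exact Metric.tendstoUniformly_iff.2 fun ε hε => Eventually.of_forall fun _ _ => by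
        rwa [dist_self]
  have : NeZero d := ⟨hd.ne'⟩
  have hpos : 0 < ∫ t, g t := by rw [hg_one]; exact one_pos
  have hsample : ∀ m, Measurable (sample X m) := fun m =>
    measurable_pi_lambda _ fun j => hX j
  have hsub : Measurable (subvector e) := by
    unfold subvector
    fun_prop
  have hN : ∀ i, IsAsymptoticallyNormal (P i)
      (fun m ω => subvector e (fullEst m (sample X m ω))) (fun m ω => Sest m (sample X m ω))
      (subvector e (full i)) (S i) := fun i =>
    { posDef := hS i
      measurable_est := fun m => hsub.comp ((hfullEst m).comp (hsample m))
      measurable_cov := fun m a b => (hSest_meas m a b).comp (hsample m)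
      posSemidef := fun m ω => hSest_psd m _
      consistent := hSest i
      tendsto_studentized := hlim i }
  have hN' := fun i => isAsymptoticallyNormal_gaussianEstimator (subvector e (full i)) (hS i)
  have hne : ∀ᶠ nk in manyObservations, nk.1 * nk.2 ≠ 0 :=
    tendsto_mul_manyObservations.eventually (eventually_ne_atTop 0)
  constructor
  · intro i x
    -- The two limits are the same indicator, so the difference tends to zero along the single index
    -- `m = n * k`.
    have h := ((hN i).tendsto_measureReal_ratio_le hg_int hg_nonneg hpos (hg_supp i) x).sub
      ((hN' i).tendsto_measureReal_ratio_le hg_int hg_nonneg hpos (hg_supp i) x)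
    rw [sub_self] at h
    refine (h.comp tendsto_mul_manyObservations).congr' ?_
    filter_upwards [hne] with nk hnk
    simp only [Function.comp_apply]
    rw [batchMSPRTCDF_eq _ (hS i) hg_int t₀ hnk]
    rfl
  · intro hcont hg0 i hi
    have hN₀ := hN i
    have hN₀' := hN' i
    rw [hi] at hN₀ hN₀'
    have h := hN₀.tendstoUniformly_sub hN₀' hg_int hcont hg0
    rw [Metric.tendstoUniformly_iff] at h ⊢
    intro ε hε
    filter_upwards [tendsto_mul_manyObservations.eventually (h ε hε), hne] with nk h hnk x
    rw [hi, batchMSPRTCDF_eq _ (hS i) hg_int t₀ hnk]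
    exact h x
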